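/- Let $k$ be a field. An algebra over a field is a vector space with a bilinear multiplication, not assumed associative, commutative or unital; $\mathrm{Aut}$ of an algebra over a field $F$ is the group of its $F$-linear multiplicative bijections. A finite-dimensional $k$-algebra $A$ is simple if its multiplication is nonzero and it has no two-sided ideals (linear subspaces stable under all left and right multiplications) other than $0$ and $A$. A linear algebraic $k$-group $G$ is given by its coordinate ring $k[G]$, a finitely generated commutative Hopf algebra over $k$ which is geometrically reduced, i.e. $\bar k\otimes_k k[G]$ is reduced; for a field extension $F/k$, $G(F)=\mathrm{Hom}_{k\text{-alg}}(k[G],F)$ is the group of $F$-rational points. Let $G$ be a linear algebraic $k$-group and suppose that $k$ contains sufficiently many elements, in the following sense: either $k$ is infinite, or there are integers $n,h\ge 0$ such that $G$ is $k$-isomorphic to a closed subgroup of $\mathrm{SL}_n$ whose ideal in $k[\mathrm{SL}_n]$ is generated by polynomials over $k$ of degree at most $h$ in the matrix entries, and $$|k|\ \ge\ \max\{\,n+3,\ r+3\,\},\qquad r:=\max\{2,\ h(n+1)\}.$$ Then there is a finite-dimensional simple $k$-algebra $A$ such that, for every field extension $F/k$, the group $G(F)$ is isomorphic to $\mathrm{Aut}(A\otimes_k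 F)$. -/

import Mathlib

universe u v w

open scoped TensorProduct

noncomputable section

/-- The full automorphism group of a (not necessarily associative or unital) algebra `B` over `F`:
the `F`-linear bijections of `B` onto itself that preserve multiplication. -/
def nonassocAut (F B : Type*) [Field F] [NonUnitalNonAssocRing B] [Module F B] :
    Subgroup (B ≃ₗ[F] B) where
  carrier := {g | ∀ x y : B, g (x * y) = g x * g y}
  mul_mem' := by
    intro g h hg hh x y
    change g (h (x * y)) = g (h x) * g (h y)
    rw [hh, hg]
  one_mem' := by
    intro x y
    rfl
  inv_mem' := by
    intro g hg x y
    apply g.injective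
    have hr : ∀ z : B, g (g⁻¹ z) = z := fun z => g.apply_symm_apply z
    rw [hg, hr, hr, hr]

/-- A (not necessarily associative or unital) algebra over `k` is simple if its multiplication is
nonzero and it has no two-sided ideals (linear subspaces stable under all left and right
multiplications) other than `0` and itself. -/
def IsSimpleNonassocAlgebra (k A : Type*) [Field k] [NonUnitalNonAssocRing A] [Module k A] :
    Prop :=
  (∃ a b : A, a * b ≠ 0) ∧
    ∀ I : Submodule k A, (∀ x ∈ I, ∀ a : A, a * x ∈ I ∧ x * a ∈ I) → I = ⊥ ∨ I = ⊤

/-- `IsSLRealization k H n h M`: the matrix `M` over the coordinate ring `H = k[G]` is the universal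
point of a closed embedding of `k`-groups `G → SL_n`, the image of which is cut out in `SL_n`
(ideal-theoretically) by polynomials over `k` of degree at most `h` in the matrix entries.

The first clause says that the entries of `M` generate `H` (the morphism is a closed embedding),
the next two that the morphism is a homomorphism of groups, and the last that the ideal of the
image is generated by `det - 1` and polynomials of degree at most `h`. -/
def IsSLRealization (k H : Type*) [Field k] [CommRing H] [HopfAlgebra k H] (n h : ℕ)
    (M : Matrix (Fin n) (Fin n) H) : Prop :=
  let φ : MvPolynomial (Fin n × Fin n) k →ₐ[k] H := MvPolynomial.aeval fun p => M p.1 p.2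
  Function.Surjective φ ∧
  (∀ i j, Coalgebra.comul (R := k) (M i j) = ∑ l, M i l ⊗ₜ[k] M l j) ∧
  (∀ i j, Coalgebra.counit (R := k) (M i j) = if i = j then 1 else 0) ∧
  RingHom.ker φ =
    Ideal.span ({(Matrix.mvPolynomialX (Fin n) (Fin n) k).det - 1} ∪
      {p | φ p = 0 ∧ p.totalDegree ≤ h})

/-- The field `k` contains sufficiently many elements for the linear algebraic `k`-group `G` with
coordinate ring `H`: either `k` is infinite, or `|k| ≥ max (n + 3) (r + 3)`, `r = max 2 (h (n + 1))`,
where `G` is `k`-isomorphic to a closed subgroup of `SL_n` that is cut out in `SL_n` by polynomials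
over `k` of degree at most `h`. -/
def HasSufficientlyManyElements (k H : Type*) [Field k] [CommRing H] [HopfAlgebra k H] : Prop :=
  Infinite k ∨
    ∃ (n h : ℕ) (M : Matrix (Fin n) (Fin n) H),
      IsSLRealization k H n h M ∧ max (n + 3) (max 2 (h * (n + 1)) + 3) ≤ Nat.card k

end

/-! The group is first realised as the symmetry group of finite linear-algebra data, and these data
are then made rigid inside one simple algebra.

Let `C` be a finite-dimensional subcoalgebra of `H = k[G]` that contains 1 and generates `H`. Let
`d` exceed the degrees of finitely many defining relations between generators in `C`, and put `U = C
^ d`, `V = U * U`. A point `x` of `G(F)` acts on `U` and `V` by `(id ⊗ x) ∘ Δ`; this commutes with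
the translations `(f ⊗ id) ∘ Δ` of `U`, with `U ⊆ V` and with `U × U → V`. Conversely, let `(M, N)`
be a pair of matrices with these symmetries and `M ≠ 0`. The linear form `ε ∘ N` is multiplicative
on `U`, so it agrees there with an algebra homomorphism `x : H → F` (`exists_algHom_eq_on_pow`).
Commutation with translations recovers `M` from `x` (`formOfMatrix_coeff`), and `V = U * U` then
recovers `N` (`IsEquivariant.exists_algHom`). Thus `G(F)` is the stabiliser in `GL(W_F)`, `W = U ⊕
V`, of finitely many operators `T_i` and one bilinear product.

`Rigid` encodes such data in the space chain ⊕ `W` ⊕ `W*`, where the chain element `a_i` acts on `W`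
by `T_i` from the left and by `T_{i+1}` from the right. An element is determined by its left
multiplication, `a_0` is a left identity, and `a_{i+1} x = x a_i`; so automorphisms fix every `a_i`
(`map_gen`). The normalized operators single out `W` and `W*` through `a_1, a_2, a_3`, so both are
preserved. The pairing of `W*` with `W`, with values in the line of `a_0`, forces the contragredient
action on `W*` and also yields simplicity. Hence the automorphism group is exactly the stabiliser
(`stabEquiv`). The structure constants lie in `k`, so the same description holds over every
extension. -/

noncomputable section

open scoped TensorProduct Matrix
open Coalgebra (comul counit)

/-! ### The chain algebra and the rigidified algebra -/

/-- The product of basis elements in the chain algebra with basis `a₀, …, a_{r+3}`: one has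
`a_i a_j = a_{j-i}` for `i ≤ j` and `a_i a_j = a_{i-j-1}` otherwise, so that
`a_{i+1} x = x a_i` for all `x`. -/
def chainIndex {r : ℕ} (i j : Fin (r + 4)) : Fin (r + 4) :=
  if i ≤ j then ⟨j - i, by omega⟩ else ⟨i - j - 1, by omega⟩

/-- The multiplication of the chain algebra. -/
def chainMul {r : ℕ} {F : Type*} [Semiring F] (x y : Fin (r + 4) → F) : Fin (r + 4) → F :=
  fun l => ∑ i, ∑ j, if chainIndex i j = l then x i * y j else 0

/-- A bilinear multiplication and a sequence of linear operators on the space `ι → F`. -/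
structure OperatorAlgebra (r : ℕ) (ι F : Type*) where
  /-- the structure constants of the multiplication -/
  mulCoeff : ι → ι → ι → F
  /-- the operators -/
  op : ℕ → Matrix ι ι F

namespace OperatorAlgebra

/-- Base change of the structure constants. -/
def map {r : ℕ} {ι F K : Type*} (D : OperatorAlgebra r ι F) (φ : F → K) :
    OperatorAlgebra r ι K where
  mulCoeff i j l := φ (D.mulCoeff i j l)
  op i := (D.op i).map φ

/-- Normalization of the first four operators and of the last one. -/
structure IsNormalized {r : ℕ} {ι F : Type*} [DecidableEq ι] [Zero F] [One F]
    (D : OperatorAlgebra r ι F) : Prop where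
  op_zero : D.op 0 = 1
  op_one : D.op 1 = 0
  op_two : D.op 2 = 0
  op_three : D.op 3 = 1
  op_last : D.op (r + 4) = 1

/-- The bilinear multiplication on `ι → F`. -/
def mulVec {r : ℕ} {ι F : Type*} [Fintype ι] [Semiring F] (D : OperatorAlgebra r ι F)
    (u v : ι → F) : ι → F :=
  fun l => ∑ i, ∑ j, D.mulCoeff i j l * (u i * v j)

/-- The space underlying the rigidified algebra: the sum of the chain algebra, of `ι → F`, and of
the dual of `ι → F`. -/
@[ext]
structure Rigid {r : ℕ} {ι F : Type*} (D : OperatorAlgebra r ι F) where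
  /-- the component in the chain algebra -/
  chain : Fin (r + 4) → F
  /-- the component in `ι → F` -/
  vec : ι → F
  /-- the component in the dual of `ι → F` -/
  covec : ι → F

namespace Rigid

variable {r : ℕ} {ι F : Type*} {D : OperatorAlgebra r ι F}

/-- The components of an element of the rigidified algebra. -/
def equivProd (D : OperatorAlgebra r ι F) :
    Rigid D ≃ (Fin (r + 4) → F) × (ι → F) × (ι → F) where
  toFun X := (X.chain, X.vec, X.covec)
  invFun X := ⟨X.1, X.2.1, X.2.2⟩
  left_inv _ := rfl
  right_inv _ := rfl

section Field
variable [Field F]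

instance : AddCommGroup (Rigid D) := (equivProd D).addCommGroup
instance : Module F (Rigid D) := (equivProd D).module F

@[simp] lemma chain_zero : (0 : Rigid D).chain = 0 := rfl
@[simp] lemma vec_zero : (0 : Rigid D).vec = 0 := rfl
@[simp] lemma covec_zero : (0 : Rigid D).covec = 0 := rfl
@[simp] lemma chain_add (X Y : Rigid D) : (X + Y).chain = X.chain + Y.chain := rfl
@[simp] lemma vec_add (X Y : Rigid D) : (X + Y).vec = X.vec + Y.vec := rfl
@[simp] lemma covec_add (X Y : Rigid D) : (X + Y).covec = X.covec + Y.covec := rfl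
@[simp] lemma chain_smul (c : F) (X : Rigid D) : (c • X).chain = c • X.chain := rfl
@[simp] lemma vec_smul (c : F) (X : Rigid D) : (c • X).vec = c • X.vec := rfl
@[simp] lemma covec_smul (c : F) (X : Rigid D) : (c • X).covec = c • X.covec := rfl

/-- The components of an element of the rigidified algebra, linearly. -/
def linearEquivProd (D : OperatorAlgebra r ι F) :
    Rigid D ≃ₗ[F] (Fin (r + 4) → F) × (ι → F) × (ι → F) where
  __ := equivProd D
  map_add' _ _ := rfl
  map_smul' _ _ := rfl

variable [Fintype ι]

instance : FiniteDimensional F (Rigid D) :=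
  (linearEquivProd D).symm.finiteDimensional

instance : Mul (Rigid D) where
  mul X Y :=
    { chain := chainMul X.chain Y.chain + Pi.single 0 (X.covec ⬝ᵥ Y.vec)
      vec := ∑ i : Fin (r + 4), X.chain i • (D.op i *ᵥ Y.vec) +
        ∑ i : Fin (r + 4), Y.chain i • (D.op (i + 1) *ᵥ X.vec) + D.mulVec X.vec Y.vec
      covec := X.chain 0 • Y.covec + Y.chain (Fin.last _) • X.covec }

lemma chain_mul (X Y : Rigid D) :
    (X * Y).chain = chainMul X.chain Y.chain + Pi.single 0 (X.covec ⬝ᵥ Y.vec) := rfl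
lemma vec_mul (X Y : Rigid D) :
    (X * Y).vec = ∑ i : Fin (r + 4), X.chain i • (D.op i *ᵥ Y.vec) +
      ∑ i : Fin (r + 4), Y.chain i • (D.op (i + 1) *ᵥ X.vec) + D.mulVec X.vec Y.vec := rfl
lemma covec_mul (X Y : Rigid D) :
    (X * Y).covec = X.chain 0 • Y.covec + Y.chain (Fin.last _) • X.covec := rfl

end Field
end Rigid

/-! ### Bilinearity and structure constants -/

section mulLemmas
variable {r : ℕ} {ι F : Type*} [Field F]

lemma _root_.chainMul_add (x y z : Fin (r + 4) → F) :
    chainMul x (y + z) = chainMul x y + chainMul x z := by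
  ext l
  simp only [chainMul, Pi.add_apply, ← Finset.sum_add_distrib]
  refine Finset.sum_congr rfl fun i _ => Finset.sum_congr rfl fun j _ => ?_
  split_ifs <;> ring

lemma _root_.add_chainMul (x y z : Fin (r + 4) → F) :
    chainMul (x + y) z = chainMul x z + chainMul y z := by
  ext l
  simp only [chainMul, Pi.add_apply, ← Finset.sum_add_distrib]
  refine Finset.sum_congr rfl fun i _ => Finset.sum_congr rfl fun j _ => ?_
  split_ifs <;> ring

lemma _root_.smul_chainMul (c : F) (x y : Fin (r + 4) → F) :
    chainMul (c • x) y = c • chainMul x y := by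
  ext l
  simp only [chainMul, Pi.smul_apply, smul_eq_mul, Finset.mul_sum]
  refine Finset.sum_congr rfl fun i _ => Finset.sum_congr rfl fun j _ => ?_
  split_ifs <;> ring

lemma _root_.chainMul_smul (c : F) (x y : Fin (r + 4) → F) :
    chainMul x (c • y) = c • chainMul x y := by
  ext l
  simp only [chainMul, Pi.smul_apply, smul_eq_mul, Finset.mul_sum]
  refine Finset.sum_congr rfl fun i _ => Finset.sum_congr rfl fun j _ => ?_
  split_ifs <;> ring

@[simp] lemma _root_.chainMul_zero (x : Fin (r + 4) → F) : chainMul x 0 = 0 := by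
  ext l; simp [chainMul]

@[simp] lemma _root_.zero_chainMul (x : Fin (r + 4) → F) : chainMul 0 x = 0 := by
  ext l; simp [chainMul]

lemma _root_.single_chainMul (i : Fin (r + 4)) (x : Fin (r + 4) → F) (l : Fin (r + 4)) :
    chainMul (Pi.single i 1) x l = ∑ j, if chainIndex i j = l then x j else 0 := by
  rw [chainMul, Finset.sum_eq_single i]
  · simp
  · intro j _ hj
    simp [hj]
  · simp

lemma _root_.chainMul_single (i : Fin (r + 4)) (x : Fin (r + 4) → F) (l : Fin (r + 4)) :
    chainMul x (Pi.single i 1) l = ∑ j, if chainIndex j i = l then x j else 0 := by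
  rw [chainMul]
  refine Finset.sum_congr rfl fun j _ => ?_
  rw [Finset.sum_eq_single i]
  · simp
  · intro j _ hj
    simp [hj]
  · simp

lemma _root_.chainIndex_succ {i i' : Fin (r + 4)} (h : (i' : ℕ) = i + 1) (j : Fin (r + 4)) :
    chainIndex i' j = chainIndex j i := by
  unfold chainIndex
  split_ifs <;> simp only [Fin.le_def, Fin.ext_iff] at * <;> omega

lemma _root_.chainIndex_zero_left (j : Fin (r + 4)) : chainIndex 0 j = j := by
  simp [chainIndex]

variable [Fintype ι] {D : OperatorAlgebra r ι F}

lemma mulVec_add (u v w : ι → F) : D.mulVec u (v + w) = D.mulVec u v + D.mulVec u w := by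
  ext l
  simp only [mulVec, Pi.add_apply, ← Finset.sum_add_distrib]
  refine Finset.sum_congr rfl fun i _ => Finset.sum_congr rfl fun j _ => ?_
  ring

lemma add_mulVec (u v w : ι → F) : D.mulVec (u + v) w = D.mulVec u w + D.mulVec v w := by
  ext l
  simp only [mulVec, Pi.add_apply, ← Finset.sum_add_distrib]
  refine Finset.sum_congr rfl fun i _ => Finset.sum_congr rfl fun j _ => ?_
  ring

lemma smul_mulVec (c : F) (u v : ι → F) : D.mulVec (c • u) v = c • D.mulVec u v := by
  ext l
  simp only [mulVec, Pi.smul_apply, smul_eq_mul, Finset.mul_sum]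
  refine Finset.sum_congr rfl fun i _ => Finset.sum_congr rfl fun j _ => ?_
  ring

lemma mulVec_smul (c : F) (u v : ι → F) : D.mulVec u (c • v) = c • D.mulVec u v := by
  ext l
  simp only [mulVec, Pi.smul_apply, smul_eq_mul, Finset.mul_sum]
  refine Finset.sum_congr rfl fun i _ => Finset.sum_congr rfl fun j _ => ?_
  ring

@[simp] lemma mulVec_zero (u : ι → F) : D.mulVec u 0 = 0 := by
  ext l; simp [mulVec]

@[simp] lemma zero_mulVec (u : ι → F) : D.mulVec 0 u = 0 := by
  ext l; simp [mulVec]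

lemma mulVec_single [DecidableEq ι] (i j : ι) :
    D.mulVec (Pi.single i 1) (Pi.single j 1) = D.mulCoeff i j := by
  ext l
  rw [mulVec, Finset.sum_eq_single i, Finset.sum_eq_single j]
  · simp
  · intro b _ hb
    simp [hb]
  · simp
  · intro b _ hb
    simp [hb]
  · simp

end mulLemmas

/-! ### Rigidity of the chain, and simplicity -/

namespace Rigid
variable {r : ℕ} {ι F : Type*} [Field F] [Fintype ι] {D : OperatorAlgebra r ι F}

instance : NonUnitalNonAssocRing (Rigid D) where
  left_distrib X Y Z := by
    ext1 <;> simp only [chain_mul, vec_mul, covec_mul, chain_add, vec_add, covec_add,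
      chainMul_add, mulVec_add, dotProduct_add, Pi.single_add, Matrix.mulVec_add, smul_add,
      Finset.sum_add_distrib, add_smul, Pi.add_apply] <;> abel
  right_distrib X Y Z := by
    ext1 <;> simp only [chain_mul, vec_mul, covec_mul, chain_add, vec_add, covec_add,
      add_chainMul, add_mulVec, add_dotProduct, Pi.single_add, Matrix.mulVec_add, smul_add,
      Finset.sum_add_distrib, add_smul, Pi.add_apply] <;> abel
  zero_mul X := by
    ext1 <;> simp [chain_mul, vec_mul, covec_mul]
  mul_zero X := by
    ext1 <;> simp [chain_mul, vec_mul, covec_mul]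

instance : IsScalarTower F (Rigid D) (Rigid D) where
  smul_assoc c X Y := by
    ext1
    · simp only [smul_eq_mul, chain_mul, chain_smul, covec_smul, smul_chainMul, smul_dotProduct,
        smul_add, ← Pi.single_smul]
    · simp only [smul_eq_mul, vec_mul, vec_smul, chain_smul, smul_mulVec, smul_add,
        Finset.smul_sum, Pi.smul_apply, Matrix.mulVec_smul, mul_smul]
      simp only [smul_comm c]
    · simp only [smul_eq_mul, covec_mul, covec_smul, chain_smul, smul_add, Pi.smul_apply, mul_smul]
      simp only [smul_comm c]

instance : SMulCommClass F (Rigid D) (Rigid D) where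
  smul_comm c X Y := by
    ext1
    · simp only [smul_eq_mul, chain_mul, chain_smul, vec_smul, chainMul_smul, dotProduct_smul,
        smul_add, ← Pi.single_smul]
    · simp only [smul_eq_mul, vec_mul, vec_smul, chain_smul, mulVec_smul, smul_add,
        Finset.smul_sum, Pi.smul_apply, Matrix.mulVec_smul, mul_smul]
      simp only [smul_comm c]
    · simp only [smul_eq_mul, covec_mul, covec_smul, chain_smul, smul_add, Pi.smul_apply, mul_smul]
      simp only [smul_comm c]

/-- The basis elements of the chain algebra. -/
def gen (D : OperatorAlgebra r ι F) (i : Fin (r + 4)) : Rigid D := ⟨Pi.single i 1, 0, 0⟩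
/-- The inclusion of `ι → F`. -/
def ofVec (D : OperatorAlgebra r ι F) (u : ι → F) : Rigid D := ⟨0, u, 0⟩
/-- The inclusion of the dual of `ι → F`. -/
def ofCovec (D : OperatorAlgebra r ι F) (ξ : ι → F) : Rigid D := ⟨0, 0, ξ⟩

lemma sum_single_smul {V : Type*} [AddCommGroup V] [Module F V] (i : Fin (r + 4))
    (f : Fin (r + 4) → V) : ∑ j, (Pi.single i 1 : Fin (r + 4) → F) j • f j = f i := by
  rw [Finset.sum_eq_single i]
  · simp
  · intro j _ hj
    simp [hj]
  · simp

lemma gen_mul (i : Fin (r + 4)) (X : Rigid D) :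
    gen D i * X = ⟨chainMul (Pi.single i 1) X.chain, D.op i *ᵥ X.vec,
      (Pi.single i 1 : Fin (r + 4) → F) 0 • X.covec⟩ := by
  ext1 <;> simp [chain_mul, vec_mul, covec_mul, gen]

lemma mul_gen (i : Fin (r + 4)) (X : Rigid D) :
    X * gen D i = ⟨chainMul X.chain (Pi.single i 1), D.op (i + 1) *ᵥ X.vec,
      (Pi.single i 1 : Fin (r + 4) → F) (Fin.last _) • X.covec⟩ := by
  ext1
  · simp [chain_mul, gen]
  · simp only [vec_mul, gen, Matrix.mulVec_zero, smul_zero, Finset.sum_const_zero, mulVec_zero,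
      add_zero, zero_add]
    exact sum_single_smul i fun i : Fin (r + 4) => D.op (i + 1) *ᵥ X.vec
  · simp [covec_mul, gen]

lemma ofCovec_mul_ofVec (ξ u : ι → F) :
    ofCovec D ξ * ofVec D u = (ξ ⬝ᵥ u) • gen D 0 := by
  ext1
  · ext l
    simp [chain_mul, ofCovec, ofVec, gen, Pi.single_apply]
  · simp [vec_mul, ofCovec, ofVec, gen]
  · simp [covec_mul, ofCovec, ofVec, gen]

lemma ofVec_mul_ofVec (u v : ι → F) : ofVec D u * ofVec D v = ofVec D (D.mulVec u v) := by
  ext1 <;> simp [chain_mul, vec_mul, covec_mul, ofVec]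

lemma mul_ofCovec (X : Rigid D) (ξ : ι → F) : X * ofCovec D ξ = ofCovec D (X.chain 0 • ξ) := by
  ext1 <;> simp [chain_mul, vec_mul, covec_mul, ofCovec]

lemma gen_mul_ofVec (i : Fin (r + 4)) (u : ι → F) :
    gen D i * ofVec D u = ofVec D (D.op i *ᵥ u) := by
  rw [gen_mul]
  simp [ofVec]

/-- On vectors both sides are the operator of index `i + 1`: this is why right multiplication is
shifted by one. On covectors both sides vanish, since only `a_0` acts nontrivially from the left and
only the last generator from the right. -/
lemma gen_succ_mul {i i' : Fin (r + 4)} (h : (i' : ℕ) = i + 1) (X : Rigid D) :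
    gen D i' * X = X * gen D i := by
  rw [gen_mul, mul_gen]
  ext1
  · ext l
    simp [single_chainMul, chainMul_single, chainIndex_succ h]
  · simp [h]
  · have h1 : i' ≠ 0 := by rintro rfl; simp at h
    have h2 : i ≠ Fin.last _ := by
      rintro rfl
      have := i'.isLt
      simp at h
      omega
    simp [h1.symm, h2.symm]

variable [DecidableEq ι]

lemma gen_zero_mul (hD : D.IsNormalized) (X : Rigid D) : gen D 0 * X = X := by
  rw [gen_mul]
  ext1
  · ext l
    simp [single_chainMul, chainIndex_zero_left]
  · simp [hD.op_zero]
  · simp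

/-- Right multiplication by the last generator is already injective: it reverses the chain basis and
is the identity on vectors and covectors. -/
lemma eq_zero_of_mul_eq_zero (hD : D.IsNormalized) (X : Rigid D) (h : ∀ Y, X * Y = 0) :
    X = 0 := by
  have h1 := h (gen D (Fin.last _))
  rw [mul_gen] at h1
  rw [Rigid.ext_iff] at h1
  obtain ⟨h1, h2, h3⟩ := h1
  ext1
  · ext i
    have h4 : chainMul X.chain (Pi.single (Fin.last _) 1) (Fin.rev i) = 0 :=
      congrFun h1 (Fin.rev i)
    rw [chainMul_single, Finset.sum_eq_single i] at h4
    · rw [if_pos] at h4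
      · exact h4
      · rw [chainIndex, if_pos (Fin.le_last i), Fin.ext_iff, Fin.val_rev]
        simp
    · intro j _ hj
      rw [if_neg]
      rw [chainIndex, if_pos (Fin.le_last j), Fin.ext_iff, Fin.val_rev]
      simp only [Fin.val_last]
      have : (j : ℕ) ≠ i := fun h => hj (Fin.ext h)
      omega
    · simp
  · simpa [hD.op_last] using h2
  · simpa using h3

lemma eq_of_mul_eq (hD : D.IsNormalized) {X Y : Rigid D} (h : ∀ Z, X * Z = Y * Z) : X = Y :=
  sub_eq_zero.1 <| eq_zero_of_mul_eq_zero hD _ fun Z => by rw [sub_mul, h, sub_self]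

/-- By `eq_of_mul_eq`, `a_0` is the only left identity, and `a_{i+1}` is the only element whose left
multiplication is right multiplication by `a_i`. Both characterisations are invariant under
automorphisms. -/
lemma map_gen (hD : D.IsNormalized) {g : Rigid D ≃ₗ[F] Rigid D}
    (hg : g ∈ nonassocAut F (Rigid D)) (i : Fin (r + 4)) : g (gen D i) = gen D i := by
  obtain ⟨i, hi⟩ := i
  induction i with
  | zero =>
    refine eq_of_mul_eq hD fun Z => ?_
    obtain ⟨Z, rfl⟩ := g.surjective Z
    rw [← hg]
    change g (gen D 0 * Z) = gen D 0 * g Z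
    rw [gen_zero_mul hD, gen_zero_mul hD]
  | succ i ih =>
    refine eq_of_mul_eq hD fun Z => ?_
    obtain ⟨Z, rfl⟩ := g.surjective Z
    rw [← hg, gen_succ_mul (i := ⟨i, by omega⟩) rfl, gen_succ_mul (i := ⟨i, by omega⟩) rfl, hg, ih]

/-- Since `a_1 a_j = a_{j-1}` for `j ≥ 1` and `a_1 a_0 = a_0`, the first equation kills the
coefficients from 2 on and gives `x_0 + x_1 = 0`. The coefficient of `a_0` in the second is `x_1 +
x_2`. -/
lemma chain_eq_zero {x : Fin (r + 4) → F} (h1 : chainMul (Pi.single 1 1) x = 0)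
    (h2 : chainMul (Pi.single 2 1) x = 0) : x = 0 := by
  have v1 : ((1 : Fin (r + 4)) : ℕ) = 1 := rfl
  have v2 : ((2 : Fin (r + 4)) : ℕ) = 2 := rfl
  have v0 : ((0 : Fin (r + 4)) : ℕ) = 0 := rfl
  have big : ∀ i : Fin (r + 4), 2 ≤ (i : ℕ) → x i = 0 := by
    intro i hi
    have h := congrFun h1 ⟨i - 1, by omega⟩
    rw [single_chainMul, Finset.sum_eq_single i] at h
    · rwa [if_pos] at h
      rw [chainIndex, if_pos (by rw [Fin.le_def]; omega)]
      simp
    · intro j _ hj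
      have : (j : ℕ) ≠ i := fun h => hj (Fin.ext h)
      rw [if_neg]
      unfold chainIndex
      split_ifs <;> simp only [Fin.le_def, Fin.ext_iff] at * <;> omega
    · simp
  have one : x 1 = 0 := by
    have h := congrFun h2 0
    rw [single_chainMul, Finset.sum_eq_single 1] at h
    · rwa [if_pos] at h
      unfold chainIndex
      split_ifs <;> simp only [Fin.le_def, Fin.ext_iff] at * <;> omega
    · intro j _ hj
      have : (j : ℕ) ≠ 1 := fun h => hj (Fin.ext h)
      by_cases hj' : 2 ≤ (j : ℕ)
      · simp [big j hj']
      · rw [if_neg]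
        unfold chainIndex
        split_ifs <;> simp only [Fin.le_def, Fin.ext_iff] at * <;> omega
    · simp
  have zero : x 0 = 0 := by
    have h := congrFun h1 0
    rw [single_chainMul, Finset.sum_eq_single 0] at h
    · rwa [if_pos] at h
      unfold chainIndex
      split_ifs <;> simp only [Fin.le_def, Fin.ext_iff] at * <;> omega
    · intro j _ hj
      have : (j : ℕ) ≠ 0 := fun h => hj (Fin.ext h)
      by_cases hj' : 2 ≤ (j : ℕ)
      · simp [big j hj']
      · have : j = 1 := Fin.ext (by omega)
        simp [this, one]
    · simp
  ext i
  by_cases h : 2 ≤ (i : ℕ)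
  · exact big i h
  · by_cases h' : (i : ℕ) = 1
    · rw [show i = 1 from Fin.ext h']; exact one
    · rw [show i = 0 from Fin.ext (by simp; omega)]; exact zero

/-- The generators `a_1` and `a_2` annihilate vectors and covectors but have no common kernel on the
chain; `a_3` then separates vectors, where it is 1, from covectors, where it is 0. -/
lemma eq_ofVec_iff (hD : D.IsNormalized) (X : Rigid D) :
    X = ofVec D X.vec ↔ gen D 1 * X = 0 ∧ gen D 2 * X = 0 ∧ gen D 3 * X = X := by
  have v1 : ((1 : Fin (r + 4)) : ℕ) = 1 := rfl
  have v2 : ((2 : Fin (r + 4)) : ℕ) = 2 := rfl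
  have v3 : ((3 : Fin (r + 4)) : ℕ) = 3 := rfl
  constructor
  · intro h
    rw [h]
    simp only [gen_mul_ofVec, v1, v2, v3, hD.op_one, hD.op_two, hD.op_three]
    simp [ofVec, Rigid.ext_iff]
  · rintro ⟨h1, h2, h3⟩
    rw [gen_mul, Rigid.ext_iff] at h1 h2 h3
    have h4 : X.chain = 0 := chain_eq_zero h1.1 h2.1
    ext1
    · exact h4
    · rfl
    · rw [← h3.2.2]
      have : (0 : Fin (r + 4)) ≠ 3 := fun h => by
        have := congrArg Fin.val h
        rw [v3] at this
        simp at this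
      simp [ofVec, this]

lemma eq_ofCovec_iff (hD : D.IsNormalized) (X : Rigid D) :
    X = ofCovec D X.covec ↔ gen D 1 * X = 0 ∧ gen D 2 * X = 0 ∧ gen D 3 * X = 0 := by
  have v1 : ((1 : Fin (r + 4)) : ℕ) = 1 := rfl
  have v2 : ((2 : Fin (r + 4)) : ℕ) = 2 := rfl
  have v3 : ((3 : Fin (r + 4)) : ℕ) = 3 := rfl
  constructor
  · intro h
    rw [h]
    have e1 : (0 : Fin (r + 4)) ≠ 1 := fun h => by
      have := congrArg Fin.val h
      rw [v1] at this
      simp at this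
    have e2 : (0 : Fin (r + 4)) ≠ 2 := fun h => by
      have := congrArg Fin.val h
      rw [v2] at this
      simp at this
    have e3 : (0 : Fin (r + 4)) ≠ 3 := fun h => by
      have := congrArg Fin.val h
      rw [v3] at this
      simp at this
    simp [gen_mul, ofCovec, Rigid.ext_iff, e1, e2, e3]
  · rintro ⟨h1, h2, h3⟩
    rw [gen_mul, Rigid.ext_iff] at h1 h2 h3
    have h4 : X.chain = 0 := chain_eq_zero h1.1 h2.1
    ext1
    · exact h4
    · have h5 := h3.2.1
      rw [v3, hD.op_three] at h5
      simpa [ofCovec] using h5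
    · rfl

/-- As `a_0` is a left identity, it suffices to produce it in each nonzero ideal. The pairing of
covectors with vectors takes values in its line. -/
lemma isSimple (hD : D.IsNormalized) [Nonempty ι] : IsSimpleNonassocAlgebra F (Rigid D) := by
  obtain ⟨i₀⟩ := ‹Nonempty ι›
  refine ⟨⟨gen D 0, gen D 0, ?_⟩, fun I hI => ?_⟩
  · rw [gen_zero_mul hD]
    intro h
    have := congrFun (congrArg chain h) 0
    simp [gen] at this
  rw [or_iff_not_imp_left]
  intro hbot
  obtain ⟨X, hX, hX0⟩ := Submodule.exists_mem_ne_zero_of_ne_bot hbot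
  suffices h : gen D 0 ∈ I by
    rw [eq_top_iff]
    intro Y _
    rw [← gen_zero_mul hD Y]
    exact (hI _ h Y).2
  have step_zero : ∀ Y ∈ I, Y.chain 0 ≠ 0 → gen D 0 ∈ I := by
    intro Y hY h0
    have h1 := (hI _ hY (ofCovec D (Pi.single i₀ 1))).2
    rw [mul_ofCovec] at h1
    have h2 := (hI _ h1 (ofVec D (Pi.single i₀ (Y.chain 0)⁻¹))).2
    rw [ofCovec_mul_ofVec] at h2
    simpa [h0] using h2
  have step_chain : ∀ Y ∈ I, Y.chain ≠ 0 → gen D 0 ∈ I := by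
    intro Y hY h0
    by_contra hcon
    apply h0
    -- One has `a_n a_j = a_0` only for `j = n` and `j = n - 1`. So if the coefficients of `Y` below
    -- `n` vanish, the coefficient of `a_0` in `a_n Y` is the `n`-th coefficient of `Y`.
    have key : ∀ n (hn : n < r + 4), Y.chain ⟨n, hn⟩ = 0 := by
      intro n
      induction n using Nat.strong_induction_on with
      | _ n ih =>
        intro hn
        by_contra hne
        refine hcon (step_zero _ (hI _ hY (gen D ⟨n, hn⟩)).1 ?_)
        rw [gen_mul]
        change chainMul _ _ _ ≠ _
        rw [single_chainMul, Finset.sum_eq_single ⟨n, hn⟩]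
        · rw [if_pos]
          · exact hne
          · simp [chainIndex]
        · intro j _ hj
          have hj' : (j : ℕ) ≠ n := fun h => hj (Fin.ext h)
          by_cases hlt : (j : ℕ) < n
          · simp [ih j hlt j.isLt]
          · rw [if_neg]
            rw [chainIndex, if_pos (by rw [Fin.le_def]; simp; omega), Fin.ext_iff]
            simp
            omega
        · simp
    ext i
    exact key i i.isLt
  by_cases h1 : X.chain = 0
  swap
  · exact step_chain X hX h1
  by_cases h2 : X.covec = 0
  · have h3 : X.vec ≠ 0 := by
      intro h3
      apply hX0
      ext1 <;> simp [*]
    obtain ⟨i, hi⟩ := Function.ne_iff.1 h3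
    have h4 := (hI _ hX (ofCovec D (Pi.single i 1))).1
    refine step_zero _ h4 ?_
    simpa [chain_mul, ofCovec] using hi
  · obtain ⟨i, hi⟩ := Function.ne_iff.1 h2
    have h4 := (hI _ hX (ofVec D (Pi.single i 1))).2
    refine step_zero _ h4 ?_
    simpa [chain_mul, ofVec, h1] using hi

end Rigid
end OperatorAlgebra

/-! ### Automorphisms of the rigidified algebra as a matrix stabiliser -/

namespace OperatorAlgebra
variable {r : ℕ} {ι F : Type*} [Field F] [Fintype ι] {D : OperatorAlgebra r ι F}

/-- The multiplication on `ι → F` as a bilinear map. -/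
def mulBilin (D : OperatorAlgebra r ι F) : (ι → F) →ₗ[F] (ι → F) →ₗ[F] (ι → F) :=
  LinearMap.mk₂ F D.mulVec add_mulVec smul_mulVec mulVec_add mulVec_smul

variable [DecidableEq ι]

lemma mulVec_mulVec_of_single {G : Matrix ι ι F}
    (h : ∀ i j l, ∑ a, ∑ b, D.mulCoeff a b l * (G a i * G b j) = ∑ c, G l c * D.mulCoeff i j c)
    (u v : ι → F) : D.mulVec (G *ᵥ u) (G *ᵥ v) = G *ᵥ D.mulVec u v := by
  have key : D.mulBilin.compl₁₂ G.mulVecLin G.mulVecLin = D.mulBilin.compr₂ G.mulVecLin := by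
    refine LinearMap.ext_basis (Pi.basisFun F ι) (Pi.basisFun F ι) fun i j => ?_
    ext l
    simp only [Pi.basisFun_apply, LinearMap.compl₁₂_apply, Matrix.mulVecLin_apply,
      Matrix.mulVec_single_one, LinearMap.compr₂_apply, mulBilin, LinearMap.mk₂_apply,
      mulVec_single]
    exact h i j l
  exact LinearMap.congr_fun₂ key u v

/-- The group of invertible matrices which commute with the operators and preserve the
multiplication. -/
def stab (D : OperatorAlgebra r ι F) : Subgroup (Matrix ι ι F)ˣ where
  carrier := {G | (∀ i < r + 4, D.op i * G.val = G.val * D.op i) ∧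
    ∀ u v, D.mulVec (G.val *ᵥ u) (G.val *ᵥ v) = G.val *ᵥ D.mulVec u v}
  one_mem' := by simp
  mul_mem' := by
    rintro G K ⟨hG, hG'⟩ ⟨hK, hK'⟩
    refine ⟨fun i hi => ?_, fun u v => ?_⟩
    · rw [Units.val_mul, ← mul_assoc, hG i hi, mul_assoc, hK i hi, mul_assoc]
    · simp only [Units.val_mul, ← Matrix.mulVec_mulVec, hG', hK']
  inv_mem' := by
    rintro G ⟨hG, hG'⟩
    refine ⟨fun i hi => ?_, fun u v => ?_⟩
    · exact (Units.eq_inv_mul_iff_mul_eq G).2 (by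
        rw [← mul_assoc, ← hG i hi, mul_assoc, Units.mul_inv, mul_one])
    · have h := hG' (G⁻¹.val *ᵥ u) (G⁻¹.val *ᵥ v)
      simp only [Matrix.mulVec_mulVec, Units.mul_inv, Matrix.one_mulVec] at h
      rw [h, Matrix.mulVec_mulVec, Units.inv_mul, Matrix.one_mulVec]

namespace Rigid

omit [DecidableEq ι] in
lemma eq_sum (X : Rigid D) :
    X = ∑ i, X.chain i • gen D i + ofVec D X.vec + ofCovec D X.covec := by
  have h : ∑ i, X.chain i • gen D i = ⟨X.chain, 0, 0⟩ := by
    apply (linearEquivProd D).injective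
    rw [map_sum]
    simp only [map_smul]
    refine Prod.ext ?_ (Prod.ext ?_ ?_)
    · ext j
      simp [linearEquivProd, equivProd, gen, Prod.fst_sum, Finset.sum_apply, Pi.single_apply]
    · simp [linearEquivProd, equivProd, gen, Prod.snd_sum]
    · simp [linearEquivProd, equivProd, gen, Prod.snd_sum]
  rw [h]
  ext1 <;> simp [ofVec, ofCovec]

/-- The linear automorphism of the rigidified algebra given by an invertible matrix. -/
def extend (D : OperatorAlgebra r ι F) (G : (Matrix ι ι F)ˣ) : Rigid D ≃ₗ[F] Rigid D where
  toFun X := ⟨X.chain, G.val *ᵥ X.vec, X.covec ᵥ* G⁻¹.val⟩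
  invFun X := ⟨X.chain, G⁻¹.val *ᵥ X.vec, X.covec ᵥ* G.val⟩
  map_add' X Y := by ext1 <;> simp [Matrix.mulVec_add, Matrix.add_vecMul]
  map_smul' c X := by ext1 <;> simp [Matrix.mulVec_smul, Matrix.smul_vecMul]
  left_inv X := by
    ext1
    · rfl
    · simp only [Matrix.mulVec_mulVec, Units.inv_mul, Matrix.one_mulVec]
    · simp only [Matrix.vecMul_vecMul, Units.inv_mul, Matrix.vecMul_one]
  right_inv X := by
    ext1
    · rfl
    · simp only [Matrix.mulVec_mulVec, Units.mul_inv, Matrix.one_mulVec]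
    · simp only [Matrix.vecMul_vecMul, Units.mul_inv, Matrix.vecMul_one]

lemma extend_apply (G : (Matrix ι ι F)ˣ) (X : Rigid D) :
    extend D G X = ⟨X.chain, G.val *ᵥ X.vec, X.covec ᵥ* G⁻¹.val⟩ := rfl

lemma extend_mem (hD : D.IsNormalized) {G : (Matrix ι ι F)ˣ} (hG : G ∈ D.stab) :
    extend D G ∈ nonassocAut F (Rigid D) := by
  intro X Y
  obtain ⟨h1, h2⟩ := hG
  have h1' : ∀ i : ℕ, i ≤ r + 4 → ∀ u : ι → F,
      D.op i *ᵥ (G.val *ᵥ u) = G.val *ᵥ (D.op i *ᵥ u) := by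
    intro i hi u
    -- The stabiliser only constrains the operators below `r + 4`, but right multiplication by the
    -- last generator involves index `r + 4`, where the operator is 1.
    rcases hi.lt_or_eq with hi | rfl
    · rw [Matrix.mulVec_mulVec, Matrix.mulVec_mulVec, h1 i hi]
    · simp [hD.op_last]
  simp only [extend_apply]
  ext1
  · simp only [chain_mul]
    rw [← Matrix.dotProduct_mulVec, Matrix.mulVec_mulVec, Units.inv_mul, Matrix.one_mulVec]
  · simp only [vec_mul, h2, Matrix.mulVec_add, Matrix.mulVec_sum, Matrix.mulVec_smul]
    congr 2
    · exact Finset.sum_congr rfl fun i _ => by rw [h1' i (by omega)]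
    · exact Finset.sum_congr rfl fun i _ => by rw [h1' _ (by omega)]
  · simp only [covec_mul, Matrix.add_vecMul, Matrix.smul_vecMul]

lemma map_ofVec (hD : D.IsNormalized) {g : Rigid D ≃ₗ[F] Rigid D}
    (hg : g ∈ nonassocAut F (Rigid D)) (u : ι → F) :
    g (ofVec D u) = ofVec D (g (ofVec D u)).vec := by
  obtain ⟨h1, h2, h3⟩ := (eq_ofVec_iff hD (ofVec D u)).1 rfl
  rw [eq_ofVec_iff hD]
  refine ⟨?_, ?_, ?_⟩
  · rw [← map_gen hD hg 1, ← hg, h1, map_zero]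
  · rw [← map_gen hD hg 2, ← hg, h2, map_zero]
  · rw [← map_gen hD hg 3, ← hg, h3]

lemma map_ofCovec (hD : D.IsNormalized) {g : Rigid D ≃ₗ[F] Rigid D}
    (hg : g ∈ nonassocAut F (Rigid D)) (u : ι → F) :
    g (ofCovec D u) = ofCovec D (g (ofCovec D u)).covec := by
  obtain ⟨h1, h2, h3⟩ := (eq_ofCovec_iff hD (ofCovec D u)).1 rfl
  rw [eq_ofCovec_iff hD]
  refine ⟨?_, ?_, ?_⟩
  · rw [← map_gen hD hg 1, ← hg, h1, map_zero]
  · rw [← map_gen hD hg 2, ← hg, h2, map_zero]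
  · rw [← map_gen hD hg 3, ← hg, h3, map_zero]

/-- The matrix by which an endomorphism of the rigidified algebra acts on `ι → F`. -/
def vecMatrix (g : Rigid D →ₗ[F] Rigid D) : Matrix ι ι F :=
  LinearMap.toMatrix'
    { toFun := fun u => (g (ofVec D u)).vec
      map_add' := fun u v => by
        rw [← vec_add, ← map_add]
        congr
        ext1 <;> simp [ofVec]
      map_smul' := fun c u => by
        rw [RingHom.id_apply, ← vec_smul, ← map_smul]
        congr
        ext1 <;> simp [ofVec] }

lemma vecMatrix_mulVec (g : Rigid D →ₗ[F] Rigid D) (u : ι → F) :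
    vecMatrix g *ᵥ u = (g (ofVec D u)).vec := by
  rw [vecMatrix, ← Matrix.toLin'_apply, Matrix.toLin'_toMatrix']
  rfl

lemma vecMatrix_mul (hD : D.IsNormalized) {g g' : Rigid D ≃ₗ[F] Rigid D}
    (hg' : g' ∈ nonassocAut F (Rigid D)) (h : ∀ X, g (g' X) = X) :
    vecMatrix g.toLinearMap * vecMatrix g'.toLinearMap = 1 := by
  apply Matrix.toLin'.injective
  refine LinearMap.ext fun u => ?_
  rw [Matrix.toLin'_apply, ← Matrix.mulVec_mulVec, vecMatrix_mulVec, vecMatrix_mulVec,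
    Matrix.toLin'_one]
  change (g (ofVec D (g' (ofVec D u)).vec)).vec = u
  rw [← map_ofVec hD hg', h]
  rfl

/-- An automorphism fixes the chain and preserves the vectors and the covectors, so it is determined
by its matrix on vectors once its action on covectors is known to be contragredient. -/
lemma exists_extend_eq (hD : D.IsNormalized) {g : Rigid D ≃ₗ[F] Rigid D}
    (hg : g ∈ nonassocAut F (Rigid D)) : ∃ G ∈ D.stab, extend D G = g := by
  have hg' := inv_mem hg
  let G : (Matrix ι ι F)ˣ :=
    ⟨vecMatrix g.toLinearMap, vecMatrix (g⁻¹).toLinearMap,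
      vecMatrix_mul hD hg' fun X => g.apply_symm_apply X,
      vecMatrix_mul hD hg fun X => g.symm_apply_apply X⟩
  have hvec : ∀ u, g (ofVec D u) = ofVec D (G.val *ᵥ u) := by
    intro u
    rw [map_ofVec hD hg]
    congr 1
    exact (vecMatrix_mulVec g.toLinearMap u).symm
  have hinj : ∀ {u v}, ofVec D u = ofVec D v → u = v := fun h => congrArg vec h
  have hcovec : ∀ ξ, g (ofCovec D ξ) = ofCovec D (ξ ᵥ* G⁻¹.val) := by
    intro ξ
    rw [map_ofCovec hD hg]
    congr 1
    set η := (g (ofCovec D ξ)).covec with hη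
    -- Apply `g` to `ξ · u = ⟨ξ, u⟩ a_0` and compare coefficients of the fixed element `a_0`.
    have h : η ᵥ* G.val = ξ := by
      refine dotProduct_eq _ _ fun u => ?_
      rw [← Matrix.dotProduct_mulVec]
      have h1 := hg (ofCovec D ξ) (ofVec D u)
      rw [ofCovec_mul_ofVec, map_smul, map_gen hD hg, map_ofCovec hD hg, hvec,
        ofCovec_mul_ofVec] at h1
      have h2 := congrFun (congrArg chain h1) 0
      simpa [gen] using h2.symm
    rw [← h, Matrix.vecMul_vecMul, Units.mul_inv, Matrix.vecMul_one]
  refine ⟨G, ⟨fun i hi => ?_, fun u v => ?_⟩, ?_⟩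
  · apply Matrix.toLin'.injective
    refine LinearMap.ext fun u => ?_
    rw [Matrix.toLin'_apply, Matrix.toLin'_apply, ← Matrix.mulVec_mulVec, ← Matrix.mulVec_mulVec]
    apply hinj
    have h1 := hg (gen D ⟨i, hi⟩) (ofVec D u)
    rw [gen_mul_ofVec, hvec, hvec, map_gen hD hg, gen_mul_ofVec] at h1
    exact h1.symm
  · apply hinj
    rw [← ofVec_mul_ofVec, ← hvec, ← hvec, ← hvec, ← ofVec_mul_ofVec, hg]
  · refine LinearEquiv.ext fun X => ?_
    rw [eq_sum X]
    simp only [map_add, map_sum, map_smul, hvec, hcovec, map_gen hD hg]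
    congr 1
    · congr 1
      · refine Finset.sum_congr rfl fun i _ => ?_
        rw [extend_apply]
        simp [gen]
      · rw [extend_apply]
        simp [ofVec]
    · rw [extend_apply]
      simp [ofCovec]

/-- The automorphism group of the rigidified algebra is the group of invertible matrices which
commute with the operators and preserve the multiplication. -/
def stabEquiv (hD : D.IsNormalized) : D.stab ≃* nonassocAut F (Rigid D) :=
  MulEquiv.ofBijective
    ({ toFun := fun G => ⟨extend D G, extend_mem hD G.2⟩
       map_one' := by
        refine Subtype.ext (LinearEquiv.ext fun X => ?_)
        change extend D 1 X = X
        rw [extend_apply]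
        ext1 <;> simp
       map_mul' := fun G K => by
        refine Subtype.ext (LinearEquiv.ext fun X => ?_)
        change extend D (G.1 * K.1) X = extend D G.1 (extend D K.1 X)
        simp only [extend_apply, mul_inv_rev, Units.val_mul, Matrix.mulVec_mulVec,
          Matrix.vecMul_vecMul] } : D.stab →* nonassocAut F (Rigid D))
    ⟨fun G K h => by
      have h1 : extend D G.1 = extend D K.1 := congrArg Subtype.val h
      refine Subtype.ext (Units.ext (Matrix.toLin'.injective (LinearMap.ext fun u => ?_)))
      have h2 := congrArg vec (LinearEquiv.congr_fun h1 (ofVec D u))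
      exact h2, fun g => by
      obtain ⟨G, hG, h⟩ := exists_extend_eq hD g.2
      exact ⟨⟨G, hG⟩, Subtype.ext h⟩⟩

end Rigid

/-! ### Base change of the rigidified algebra -/

section baseChange
variable {k : Type*} [Field k] [Algebra k F]

omit [Fintype ι] in
lemma IsNormalized.map {D : OperatorAlgebra r ι k} (hD : D.IsNormalized) :
    (D.map (algebraMap k F)).IsNormalized where
  op_zero := by simp [OperatorAlgebra.map, hD.op_zero]
  op_one := by simp [OperatorAlgebra.map, hD.op_one]
  op_two := by simp [OperatorAlgebra.map, hD.op_two]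
  op_three := by simp [OperatorAlgebra.map, hD.op_three]
  op_last := by simp [OperatorAlgebra.map, hD.op_last]

namespace Rigid
variable (F) (D : OperatorAlgebra r ι k)

omit [Fintype ι] [DecidableEq ι] in
/-- The componentwise inclusion of the rigidified algebra in its base change. -/
def ofBase (X : Rigid D) : Rigid (D.map (algebraMap k F)) :=
  ⟨fun i => algebraMap k F (X.chain i), fun i => algebraMap k F (X.vec i),
    fun i => algebraMap k F (X.covec i)⟩

omit [DecidableEq ι] in
lemma ofBase_mul (X Y : Rigid D) : ofBase F D (X * Y) = ofBase F D X * ofBase F D Y := by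
  ext l
  · simp only [ofBase, chain_mul, chainMul, Pi.add_apply, map_add, map_sum, Pi.single_apply,
      dotProduct, apply_ite (algebraMap k F), map_mul, map_zero]
  · simp only [ofBase, vec_mul, mulVec, Pi.add_apply, Finset.sum_apply, Pi.smul_apply, smul_eq_mul,
      Matrix.mulVec, dotProduct, map_add, map_sum, map_mul]
    rfl
  · simp only [ofBase, covec_mul, Pi.add_apply, Pi.smul_apply, smul_eq_mul, map_add, map_mul]

/-- The base change of the rigidified algebra, as a linear equivalence. -/
def baseChangeEquiv : F ⊗[k] Rigid D ≃ₗ[F] Rigid (D.map (algebraMap k F)) :=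
  TensorProduct.AlgebraTensorModule.congr (LinearEquiv.refl F F) (linearEquivProd D) ≪≫ₗ
    TensorProduct.prodRight k F F _ _ ≪≫ₗ
    LinearEquiv.prodCongr (TensorProduct.piScalarRight k F F _)
      (TensorProduct.prodRight k F F _ _ ≪≫ₗ
        LinearEquiv.prodCongr (TensorProduct.piScalarRight k F F _)
          (TensorProduct.piScalarRight k F F _)) ≪≫ₗ
    (linearEquivProd (D.map (algebraMap k F))).symm

lemma baseChangeEquiv_tmul (c : F) (X : Rigid D) :
    baseChangeEquiv F D (c ⊗ₜ X) = c • ofBase F D X := by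
  ext i
  · change X.chain i • c = c * algebraMap k F (X.chain i)
    rw [Algebra.smul_def, mul_comm]
  · change X.vec i • c = c * algebraMap k F (X.vec i)
    rw [Algebra.smul_def, mul_comm]
  · change X.covec i • c = c * algebraMap k F (X.covec i)
    rw [Algebra.smul_def, mul_comm]

lemma baseChangeEquiv_mul (x y : F ⊗[k] Rigid D) :
    baseChangeEquiv F D (x * y) = baseChangeEquiv F D x * baseChangeEquiv F D y := by
  induction x with
  | zero => simp
  | add x x' hx hx' => rw [add_mul, map_add, map_add, hx, hx', add_mul]
  | tmul c X =>
    induction y with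
    | zero => simp
    | add y y' hy hy' => rw [mul_add, map_add, map_add, hy, hy', mul_add]
    | tmul d Y =>
      rw [Algebra.TensorProduct.tmul_mul_tmul, baseChangeEquiv_tmul, baseChangeEquiv_tmul,
        baseChangeEquiv_tmul, ofBase_mul, smul_mul_smul_comm]

end Rigid
end baseChange
end OperatorAlgebra

/-- Isomorphic algebras have isomorphic automorphism groups. -/
def nonassocAut.congr {F B C : Type*} [Field F] [NonUnitalNonAssocRing B] [Module F B]
    [NonUnitalNonAssocRing C] [Module F C] (e : B ≃ₗ[F] C) (he : ∀ x y, e (x * y) = e x * e y) :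
    nonassocAut F B ≃* nonassocAut F C where
  toFun g := ⟨e.symm ≪≫ₗ g.1 ≪≫ₗ e, fun x y => by
    have hs : e.symm (x * y) = e.symm x * e.symm y := e.injective (by simp [he])
    change e (g.1 (e.symm (x * y))) = e (g.1 (e.symm x)) * e (g.1 (e.symm y))
    rw [hs, g.2, he]⟩
  invFun g := ⟨e ≪≫ₗ g.1 ≪≫ₗ e.symm, fun x y => by
    change e.symm (g.1 (e (x * y))) = e.symm (g.1 (e x)) * e.symm (g.1 (e y))
    apply e.injective
    rw [he, g.2, he]
    simp⟩
  left_inv g := Subtype.ext (LinearEquiv.ext fun x => by simp)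
  right_inv g := Subtype.ext (LinearEquiv.ext fun x => by simp)
  map_mul' g h := Subtype.ext (LinearEquiv.ext fun x => by
    change e (g.1 (h.1 (e.symm x))) = e (g.1 (e.symm (e (h.1 (e.symm x)))))
    simp)

/-! ### Contractions and finite dual bases -/

section Contract
variable {k H : Type*} [Field k] [CommRing H] [Algebra k H]

/-- Contraction of the first tensor factor by a linear form. -/
def contractFst (f : H →ₗ[k] k) : H ⊗[k] H →ₗ[k] H :=
  (TensorProduct.lid k H).toLinearMap ∘ₗ f.rTensor H

@[simp] lemma contractFst_tmul (f : H →ₗ[k] k) (a b : H) : contractFst f (a ⊗ₜ b) = f a • b := by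
  simp [contractFst]

/-- A finite basis of a subspace together with dual linear forms on the whole space. -/
structure Frame (V : Submodule k H) (n : ℕ) where
  /-- the basis vectors -/
  vec : Fin n → H
  /-- the dual linear forms -/
  form : Fin n → H →ₗ[k] k
  vec_mem : ∀ i, vec i ∈ V
  sum_form_smul_vec : ∀ z ∈ V, ∑ i, form i z • vec i = z
  form_vec : ∀ i j, form i (vec j) = if i = j then 1 else 0

lemma exists_frame {V : Submodule k H} (hV : V.FG) : ∃ n, Nonempty (Frame V n) := by
  have : Module.Finite k V := Module.Finite.iff_fg.2 hV
  let b := Module.finBasis k V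
  choose f hf using fun i => LinearMap.exists_extend (b.coord i)
  refine ⟨_, ⟨⟨fun i => b i, f, fun i => (b i).2, fun z hz => ?_, fun i j => ?_⟩⟩⟩
  · have h := congrArg V.subtype (b.sum_repr ⟨z, hz⟩)
    rw [map_sum] at h
    simp only [map_smul, Submodule.subtype_apply] at h
    refine (Finset.sum_congr rfl fun i _ => ?_).trans h
    congr 1
    exact LinearMap.congr_fun (hf i) ⟨z, hz⟩
  · have h := LinearMap.congr_fun (hf i) (b j)
    change f i (b j) = b.repr (b j) i at h
    rw [h, b.repr_self, Finsupp.single_apply]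
    simp only [eq_comm]

end Contract

/-! ### Subcoalgebras and local finiteness -/

section Coalgebra
variable {k H : Type*} [Field k] [CommRing H] [Bialgebra k H]

/-- Right subcomodules of a bialgebra. -/
def IsRightSubcomodule (V : Submodule k H) : Prop :=
  ∀ z ∈ V, comul (R := k) z ∈ Submodule.map₂ (TensorProduct.mk k H H) V ⊤

/-- Subcoalgebras of a bialgebra. -/
def IsSubcoalgebra (V : Submodule k H) : Prop :=
  ∀ z ∈ V, comul (R := k) z ∈ Submodule.map₂ (TensorProduct.mk k H H) V V

lemma IsSubcoalgebra.isRightSubcomodule {V : Submodule k H} (hV : IsSubcoalgebra V) :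
    IsRightSubcomodule V :=
  fun z hz => Submodule.map₂_le_map₂_right le_top (hV z hz)

lemma IsSubcoalgebra.one : IsSubcoalgebra (1 : Submodule k H) := by
  intro z hz
  obtain ⟨c, rfl⟩ := Submodule.mem_one.1 hz
  rw [Algebra.algebraMap_eq_smul_one, map_smul, Bialgebra.comul_one,
    Algebra.TensorProduct.one_def]
  exact Submodule.smul_mem _ _ (Submodule.apply_mem_map₂ _ (Submodule.one_le.1 le_rfl)
    (Submodule.one_le.1 le_rfl))

lemma IsSubcoalgebra.sup {V W : Submodule k H} (hV : IsSubcoalgebra V) (hW : IsSubcoalgebra W) :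
    IsSubcoalgebra (V ⊔ W) := by
  intro z hz
  obtain ⟨v, hv, w, hw, rfl⟩ := Submodule.mem_sup.1 hz
  rw [map_add]
  exact Submodule.add_mem _ (Submodule.map₂_le_map₂ le_sup_left le_sup_left (hV v hv))
    (Submodule.map₂_le_map₂ le_sup_right le_sup_right (hW w hw))

lemma IsSubcoalgebra.mul {V W : Submodule k H} (hV : IsSubcoalgebra V) (hW : IsSubcoalgebra W) :
    IsSubcoalgebra (V * W) := by
  intro z hz
  refine Submodule.mul_induction_on hz (fun v hv w hw => ?_) fun x y hx hy => ?_
  · rw [Bialgebra.comul_mul]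
    have h : Submodule.map₂ (TensorProduct.mk k H H) V V *
        Submodule.map₂ (TensorProduct.mk k H H) W W ≤
        Submodule.map₂ (TensorProduct.mk k H H) (V * W) (V * W) := by
      conv_lhs => rw [← Submodule.span_eq V, ← Submodule.span_eq W]
      rw [Submodule.map₂_span_span, Submodule.map₂_span_span, Submodule.span_mul_span,
        Submodule.span_le]
      rintro _ ⟨_, ⟨a, ha, b, hb, rfl⟩, _, ⟨c, hc, d, hd, rfl⟩, rfl⟩
      simp only [TensorProduct.mk_apply, Algebra.TensorProduct.tmul_mul_tmul]
      exact Submodule.apply_mem_map₂ _ (Submodule.mul_mem_mul ha hc) (Submodule.mul_mem_mul hb hd)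
    exact h (Submodule.mul_mem_mul (hV v hv) (hW w hw))
  · rw [map_add]
    exact Submodule.add_mem _ hx hy

lemma IsSubcoalgebra.pow {V : Submodule k H} (hV : IsSubcoalgebra V) (n : ℕ) :
    IsSubcoalgebra (V ^ n) := by
  induction n with
  | zero => rw [pow_zero]; exact .one
  | succ n ih => rw [pow_succ]; exact ih.mul hV

namespace Frame
variable {V : Submodule k H} {n : ℕ} (B : Frame V n)

/-- The matrix of coefficients of a subcomodule. -/
def coeff (i j : Fin n) : H := contractFst (B.form i) (comul (R := k) (B.vec j))

include B in
lemma sum_tmul_contractFst {t : H ⊗[k] H}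
    (ht : t ∈ Submodule.map₂ (TensorProduct.mk k H H) V ⊤) :
    ∑ i, B.vec i ⊗ₜ[k] contractFst (B.form i) t = t := by
  let e : H ⊗[k] H →ₗ[k] H ⊗[k] H :=
    ∑ i, TensorProduct.mk k H H (B.vec i) ∘ₗ contractFst (B.form i)
  have h : Submodule.map₂ (TensorProduct.mk k H H) V ⊤ ≤ LinearMap.eqLocus e LinearMap.id := by
    rw [Submodule.map₂_le]
    intro v hv w _
    rw [LinearMap.mem_eqLocus]
    simp only [e, LinearMap.sum_apply, LinearMap.comp_apply, TensorProduct.mk_apply,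
      contractFst_tmul, LinearMap.id_apply, TensorProduct.tmul_smul, TensorProduct.smul_tmul']
    rw [← TensorProduct.sum_tmul, B.sum_form_smul_vec v hv]
  have := LinearMap.mem_eqLocus.1 (h ht)
  simpa [e, LinearMap.sum_apply] using this

variable (hV : IsRightSubcomodule V)
include hV

lemma comul_vec (j : Fin n) : comul (R := k) (B.vec j) = ∑ i, B.vec i ⊗ₜ[k] B.coeff i j :=
  (B.sum_tmul_contractFst (hV _ (B.vec_mem j))).symm

omit hV in
lemma contractFst_form_comul {z : H} (hz : z ∈ V) (l : Fin n) :
    contractFst (B.form l) (comul (R := k) z) = ∑ c, B.form c z • B.coeff l c := by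
  conv_lhs => rw [← B.sum_form_smul_vec z hz]
  simp only [map_sum, map_smul]
  rfl

/-- Contract the first factor of both sides of coassociativity, applied to `B.vec j`, by the form
`B.form i`. -/
lemma comul_coeff (i j : Fin n) :
    comul (R := k) (B.coeff i j) = ∑ l, B.coeff i l ⊗ₜ[k] B.coeff l j := by
  let c₃ : H ⊗[k] (H ⊗[k] H) →ₗ[k] H ⊗[k] H :=
    (TensorProduct.lid k (H ⊗[k] H)).toLinearMap ∘ₗ (B.form i).rTensor (H ⊗[k] H)
  have h1 : ∀ t : H ⊗[k] H, comul (R := k) (contractFst (B.form i) t) =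
      c₃ ((comul (R := k) (A := H)).lTensor H t) := by
    intro t
    induction t with
    | zero => simp
    | add x y hx hy => simp only [map_add, hx, hy]
    | tmul a b => simp [c₃]
  have h2 : ∀ (t : H ⊗[k] H) (h : H), c₃ (TensorProduct.assoc k H H H (t ⊗ₜ h)) =
      contractFst (B.form i) t ⊗ₜ h := by
    intro t h
    induction t with
    | zero => simp
    | add x y hx hy => simp only [TensorProduct.add_tmul, map_add, hx, hy]
    | tmul a b => simp [c₃, TensorProduct.smul_tmul']
  rw [coeff, h1, ← Coalgebra.coassoc_apply, B.comul_vec hV]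
  simp only [map_sum, LinearMap.rTensor_tmul, h2]
  rfl

omit hV in
lemma counit_coeff (i j : Fin n) : counit (R := k) (B.coeff i j) = if i = j then 1 else 0 := by
  have h1 : ∀ t : H ⊗[k] H, counit (R := k) (contractFst (B.form i) t) =
      B.form i (TensorProduct.rid k H ((counit (R := k) (A := H)).lTensor H t)) := by
    intro t
    induction t with
    | zero => simp
    | add x y hx hy => simp only [map_add, hx, hy]
    | tmul a b => simp [mul_comm]
  rw [coeff, h1, Coalgebra.lTensor_counit_comul]
  simp [B.form_vec]

lemma sum_counit_smul_contractFst {z : H} (hz : z ∈ V) :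
    ∑ i, counit (R := k) (B.vec i) • contractFst (B.form i) (comul (R := k) z) = z := by
  have h1 : contractFst (counit (R := k) (A := H)) (comul (R := k) z) = z := by
    simp [contractFst, Coalgebra.rTensor_counit_comul]
  conv_rhs => rw [← h1, ← B.sum_tmul_contractFst (hV z hz)]
  simp

lemma sum_counit_smul_coeff (j : Fin n) :
    ∑ i, counit (R := k) (B.vec i) • B.coeff i j = B.vec j :=
  B.sum_counit_smul_contractFst hV (B.vec_mem j)

omit hV in
lemma coeff_mem (hV : IsSubcoalgebra V) (i j : Fin n) : B.coeff i j ∈ V := by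
  have h : Submodule.map₂ (TensorProduct.mk k H H) V V ≤ V.comap (contractFst (B.form i)) := by
    rw [Submodule.map₂_le]
    intro v _ w hw
    simpa using V.smul_mem _ hw
  exact h (hV _ (B.vec_mem j))

end Frame

/-- Contraction of the second tensor factor by a linear form. -/
def contractSnd (f : H →ₗ[k] k) : H ⊗[k] H →ₗ[k] H :=
  (TensorProduct.rid k H).toLinearMap ∘ₗ f.lTensor H

@[simp] lemma contractSnd_tmul (f : H →ₗ[k] k) (a b : H) :
    contractSnd f (a ⊗ₜ b) = f b • a := by
  simp [contractSnd]

lemma eq_of_contractSnd_eq {s t : H ⊗[k] H} (h : ∀ f, contractSnd f s = contractSnd f t) :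
    s = t := by
  classical
  let b := Module.Basis.ofVectorSpace k H
  apply (TensorProduct.equivFinsuppOfBasisRight (M := H) b).injective
  ext i
  have key : ∀ t : H ⊗[k] H,
      TensorProduct.equivFinsuppOfBasisRight (M := H) b t i = contractSnd (b.coord i) t := by
    intro t
    induction t with
    | zero => simp
    | add x y hx hy => simp only [map_add, Finsupp.add_apply, hx, hy]
    | tmul a c => simp
  rw [key, key, h]

/-- For a linear projection `Q` onto `V`, the tensors `(Q ⊗ id) t` and `t` have the same
contractions, hence coincide. -/
lemma mem_map₂_of_contractSnd_mem {V : Submodule k H} {t : H ⊗[k] H}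
    (h : ∀ f, contractSnd f t ∈ V) : t ∈ Submodule.map₂ (TensorProduct.mk k H H) V ⊤ := by
  obtain ⟨P, hP⟩ := LinearMap.exists_extend (LinearMap.id : V →ₗ[k] V)
  let Q : H →ₗ[k] H := V.subtype ∘ₗ P
  have hQ : ∀ v ∈ V, Q v = v := fun v hv =>
    congrArg Subtype.val (LinearMap.congr_fun hP ⟨v, hv⟩)
  have h1 : ∀ t, Q.rTensor H t ∈ Submodule.map₂ (TensorProduct.mk k H H) V ⊤ := by
    intro t
    induction t with
    | zero => simp
    | add x y hx hy => rw [map_add]; exact Submodule.add_mem _ hx hy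
    | tmul a b =>
      rw [LinearMap.rTensor_tmul]
      exact Submodule.apply_mem_map₂ _ (P a).2 Submodule.mem_top
  have h2 : Q.rTensor H t = t := by
    refine eq_of_contractSnd_eq fun f => ?_
    rw [← hQ _ (h f)]
    generalize t = s
    induction s with
    | zero => simp
    | add x y hx hy => simp only [map_add, hx, hy]
    | tmul a b => simp
  rw [← h2]
  exact h1 t

/-- The subspace consists of the contractions `(id ⊗ f) Δ x`. It is finite-dimensional because `Δ x`
is a finite sum of pure tensors, and it contains `x` by taking `f = ε`. By coassociativity,
contracting again amounts to convolving the two forms. -/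
lemma exists_fg_isRightSubcomodule (x : H) :
    ∃ V : Submodule k H, V.FG ∧ IsRightSubcomodule V ∧ x ∈ V := by
  let V : Submodule k H := Submodule.span k (Set.range fun f => contractSnd f (comul (R := k) x))
  have hfg : ∀ t : H ⊗[k] H, ∃ N : Submodule k H, N.FG ∧ ∀ f, contractSnd f t ∈ N := by
    intro t
    induction t with
    | zero => exact ⟨⊥, Submodule.fg_bot, by simp⟩
    | add x y hx hy =>
      obtain ⟨M, hM, hM'⟩ := hx
      obtain ⟨N, hN, hN'⟩ := hy
      refine ⟨M ⊔ N, hM.sup hN, fun f => ?_⟩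
      rw [map_add]
      exact Submodule.add_mem_sup (hM' f) (hN' f)
    | tmul a b =>
      refine ⟨Submodule.span k {a}, Submodule.fg_span_singleton a, fun f => ?_⟩
      rw [contractSnd_tmul]
      exact Submodule.smul_mem _ _ (Submodule.mem_span_singleton_self a)
  refine ⟨V, ?_, fun z hz => mem_map₂_of_contractSnd_mem fun f => ?_, ?_⟩
  · obtain ⟨N, hN, hN'⟩ := hfg (comul (R := k) x)
    have hle : V ≤ N := Submodule.span_le.2 (by rintro _ ⟨f, rfl⟩; exact hN' f)
    have := Module.Finite.iff_fg.2 hN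
    exact Module.Finite.iff_fg.1 (Submodule.finiteDimensional_of_le hle)
  · have hle : V ≤ V.comap (contractSnd f ∘ₗ comul (R := k)) := by
      refine Submodule.span_le.2 ?_
      rintro _ ⟨g, rfl⟩
      refine Submodule.subset_span
        ⟨LinearMap.mul' k k ∘ₗ TensorProduct.map f g ∘ₗ comul (R := k), ?_⟩
      let c₃ : H ⊗[k] (H ⊗[k] H) →ₗ[k] H :=
        (TensorProduct.rid k H).toLinearMap ∘ₗ
          (LinearMap.mul' k k ∘ₗ TensorProduct.map f g).lTensor H
      have h1 : ∀ t : H ⊗[k] H,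
          contractSnd (LinearMap.mul' k k ∘ₗ TensorProduct.map f g ∘ₗ comul (R := k)) t =
            c₃ ((comul (R := k) (A := H)).lTensor H t) := by
        intro t
        induction t with
        | zero => simp
        | add x y hx hy => simp only [map_add, hx, hy]
        | tmul a b => simp [c₃]
      have h2 : ∀ (s : H ⊗[k] H) (b : H),
          c₃ (TensorProduct.assoc k H H H (s ⊗ₜ b)) = g b • contractSnd f s := by
        intro s b
        induction s with
        | zero => simp
        | add x y hx hy => simp only [TensorProduct.add_tmul, map_add, hx, hy, smul_add]
        | tmul a c => simp [c₃, mul_smul, smul_comm (g b)]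
      have h3 : ∀ t : H ⊗[k] H,
          c₃ (TensorProduct.assoc k H H H ((comul (R := k) (A := H)).rTensor H t)) =
            contractSnd f (comul (R := k) (contractSnd g t)) := by
        intro t
        induction t with
        | zero => simp
        | add x y hx hy => simp only [map_add, hx, hy]
        | tmul a b => simp [h2]
      simp only [LinearMap.comp_apply] at h1 h3 ⊢
      change contractSnd (LinearMap.mul' k k ∘ₗ TensorProduct.map f g ∘ₗ comul (R := k)) _ = _
      rw [← h3, Coalgebra.coassoc_apply]
      exact h1 _
    exact hle hz
  · refine Submodule.subset_span ⟨counit (R := k), ?_⟩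
    simp [contractSnd, Coalgebra.lTensor_counit_comul]

/-- The matrix coefficients of a finite-dimensional subcomodule span a subcoalgebra, and applying
the counit to the first factor shows that this contains the subcomodule. -/
lemma exists_fg_isSubcoalgebra (x : H) :
    ∃ C : Submodule k H, C.FG ∧ IsSubcoalgebra C ∧ x ∈ C := by
  obtain ⟨V, hV, hV', hx⟩ := exists_fg_isRightSubcomodule (k := k) x
  obtain ⟨n, ⟨B⟩⟩ := exists_frame hV
  refine ⟨Submodule.span k (Set.range fun p : Fin n × Fin n => B.coeff p.1 p.2),
    Submodule.fg_span (Set.finite_range _), fun z hz => ?_, ?_⟩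
  · set C := Submodule.span k (Set.range fun p : Fin n × Fin n => B.coeff p.1 p.2) with hC
    have hmem : ∀ i j, B.coeff i j ∈ C := fun i j => Submodule.subset_span ⟨(i, j), rfl⟩
    have hle : C ≤ (Submodule.map₂ (TensorProduct.mk k H H) C C).comap (comul (R := k)) := by
      refine Submodule.span_le.2 ?_
      rintro _ ⟨⟨i, j⟩, rfl⟩
      change comul (R := k) (B.coeff i j) ∈ Submodule.map₂ (TensorProduct.mk k H H) C C
      rw [B.comul_coeff hV']
      exact Submodule.sum_mem _ fun l _ => Submodule.apply_mem_map₂ _ (hmem i l) (hmem l j)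
    exact hle hz
  · rw [← B.sum_form_smul_vec x hx]
    refine Submodule.sum_mem _ fun j _ => Submodule.smul_mem _ _ ?_
    rw [← B.sum_counit_smul_coeff hV' j]
    exact Submodule.sum_mem _ fun i _ =>
      Submodule.smul_mem _ _ (Submodule.subset_span ⟨(i, j), rfl⟩)

lemma exists_fg_isSubcoalgebra_adjoin_eq_top [Algebra.FiniteType k H] :
    ∃ C : Submodule k H, C.FG ∧ IsSubcoalgebra C ∧ 1 ≤ C ∧ Algebra.adjoin k (C : Set H) = ⊤ := by
  obtain ⟨S, hS⟩ := Algebra.FiniteType.out (R := k) (A := H)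
  have key : ∀ S : Finset H, ∃ C : Submodule k H, C.FG ∧ IsSubcoalgebra C ∧ 1 ≤ C ∧
      (S : Set H) ⊆ C := by
    classical
    intro S
    induction S using Finset.induction_on with
    | empty => exact ⟨1, by rw [Submodule.one_eq_span]; exact Submodule.fg_span_singleton _,
        .one, le_rfl, by simp⟩
    | insert x S _ ih =>
      obtain ⟨C, h1, h2, h3, h4⟩ := ih
      obtain ⟨E, h5, h6, h7⟩ := exists_fg_isSubcoalgebra (k := k) x
      refine ⟨C ⊔ E, h1.sup h5, h2.sup h6, h3.trans le_sup_left, ?_⟩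
      rw [Finset.coe_insert, Set.insert_subset_iff]
      exact ⟨Submodule.mem_sup_right h7, fun y hy => Submodule.mem_sup_left (h4 hy)⟩
  obtain ⟨C, h1, h2, h3, h4⟩ := key S
  exact ⟨C, h1, h2, h3, top_le_iff.1 (hS ▸ Algebra.adjoin_mono h4)⟩

end Coalgebra

/-! ### Extending partially multiplicative forms to points -/

section Extension
variable {k H : Type*} [Field k] [CommRing H] [Algebra k H]

/-- If the subspace `C` generates the finitely presented algebra `H`, then for some `d` every linear
map which is multiplicative on `C ^ d` agrees there with a homomorphism of algebras. -/
theorem exists_algHom_eq_on_pow {C : Submodule k H} (hfg : C.FG) (hone : 1 ≤ C)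
    (hgen : Algebra.adjoin k (C : Set H) = ⊤) :
    ∃ d : ℕ, d ≠ 0 ∧ ∀ (F : Type*) [Field F] [Algebra k F] (ψ : H →ₗ[k] F), ψ 1 = 1 →
      (∀ a ∈ C ^ d, ∀ b ∈ C ^ d, ψ (a * b) = ψ a * ψ b) →
      ∃ x : H →ₐ[k] F, ∀ z ∈ C ^ d, x z = ψ z := by
  obtain ⟨n, c, hc⟩ := Submodule.fg_iff_exists_fin_generating_family.1 hfg
  let f : MvPolynomial (Fin n) k →ₐ[k] H := MvPolynomial.aeval c
  have hcC : ∀ i, c i ∈ C := fun i => hc ▸ Submodule.subset_span ⟨i, rfl⟩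
  have hf : Function.Surjective f := by
    rw [← AlgHom.range_eq_top, ← Algebra.adjoin_range_eq_range_aeval, ← hgen, ← hc,
      Algebra.adjoin_span]
  obtain ⟨S, hS⟩ := (isNoetherianRing_iff_ideal_fg _).1 inferInstance (RingHom.ker f)
  -- The bound covers all generators of the relation ideal; adding 1 makes `d` nonzero, so that `C ≤
  -- C ^ d`.
  let d := S.sup MvPolynomial.totalDegree + 1
  refine ⟨d, Nat.succ_ne_zero _, fun F _ _ ψ hψ1 hψ => ?_⟩
  have hle : ∀ {i}, i ≤ d → C ^ i ≤ C ^ d := fun h => pow_le_pow_right₀ hone h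
  have hle1 : C ≤ C ^ d := by
    simpa using hle (i := 1) (Nat.succ_le_of_lt (Nat.succ_pos _))
  let y : MvPolynomial (Fin n) k →ₐ[k] F := MvPolynomial.aeval fun i => ψ (c i)
  -- Split off one variable at a time: for total degree at most `d`, both factors lie in `C ^ d`,
  -- where `ψ` is multiplicative.
  have hmon : ∀ (e : ℕ) (s : Fin n →₀ ℕ), s.degree = e → e ≤ d →
      f (MvPolynomial.monomial s 1) ∈ C ^ e ∧
        ψ (f (MvPolynomial.monomial s 1)) = y (MvPolynomial.monomial s 1) := by
    intro e
    induction e with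
    | zero =>
      intro s hs _
      rw [Finsupp.degree_eq_zero_iff] at hs
      subst hs
      rw [← MvPolynomial.C_apply, MvPolynomial.C_1, map_one f, map_one y, pow_zero]
      exact ⟨(Submodule.one_le.1 le_rfl), hψ1⟩
    | succ e ih =>
      intro s hs hed
      obtain ⟨i, hi⟩ : ∃ i, s i ≠ 0 := by
        by_contra! h
        have : s = 0 := Finsupp.ext h
        simp [this] at hs
      have hsplit : Finsupp.single i 1 + (s - Finsupp.single i 1) = s :=
        add_tsub_cancel_of_le (Finsupp.single_le_iff.2 (Nat.one_le_iff_ne_zero.2 hi))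
      have hdeg : (s - Finsupp.single i 1).degree = e := by
        have := congrArg Finsupp.degree hsplit
        rw [map_add, Finsupp.degree_single, hs] at this
        omega
      obtain ⟨h1, h2⟩ := ih _ hdeg (by omega)
      have hm : MvPolynomial.monomial s (1 : k) =
          MvPolynomial.X i * MvPolynomial.monomial (s - Finsupp.single i 1) 1 := by
        rw [MvPolynomial.X, MvPolynomial.monomial_mul, hsplit, one_mul]
      have hX : f (MvPolynomial.X i) = c i := MvPolynomial.aeval_X _ _
      have hX' : y (MvPolynomial.X i) = ψ (c i) := MvPolynomial.aeval_X _ _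
      rw [hm, map_mul f, map_mul y, hX, hX', ← h2, pow_succ']
      exact ⟨Submodule.mul_mem_mul (hcC i) h1,
        hψ _ (hle1 (hcC i)) _ (hle (by omega) h1)⟩
  have hpoly : ∀ p : MvPolynomial (Fin n) k, p.totalDegree ≤ d → ψ (f p) = y p := by
    intro p hp
    rw [p.as_sum]
    simp only [map_sum]
    refine Finset.sum_congr rfl fun s hs => ?_
    have hm : MvPolynomial.monomial s (p.coeff s) =
        p.coeff s • MvPolynomial.monomial s (1 : k) := by
      rw [MvPolynomial.smul_monomial, smul_eq_mul, mul_one]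
    rw [hm, map_smul, map_smul, map_smul]
    congr 1
    exact (hmon _ s rfl ((MvPolynomial.le_totalDegree hs).trans hp)).2
  -- Each generator of the relation ideal has degree at most `d`, so `y` agrees on it with `ψ ∘ f`,
  -- which vanishes.
  have hker : RingHom.ker f ≤ RingHom.ker y := by
    rw [← hS, Ideal.span_le]
    intro p hp
    have h0 : f p = 0 := by
      have : p ∈ RingHom.ker f := hS ▸ Ideal.subset_span hp
      exact this
    change y p = 0
    rw [← hpoly p ((Finset.le_sup hp).trans (Nat.le_succ _)), h0, map_zero]
  let x : H →ₐ[k] F := AlgHom.liftOfSurjective f hf y hker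
  have hx : ∀ p, x (f p) = y p := AlgHom.liftOfSurjective_apply f hf y hker
  have hxC : ∀ z ∈ C, x z = ψ z := by
    intro z hz
    have hle : C ≤ LinearMap.eqLocus x.toLinearMap ψ := by
      rw [← hc, Submodule.span_le]
      rintro _ ⟨i, rfl⟩
      change x (c i) = ψ (c i)
      have hX : f (MvPolynomial.X i) = c i := MvPolynomial.aeval_X _ _
      rw [← hX, hx, hX]
      exact MvPolynomial.aeval_X _ _
    exact hle hz
  have hxpow : ∀ e ≤ d, ∀ z ∈ C ^ e, x z = ψ z := by
    intro e
    induction e with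
    | zero =>
      intro _ z hz
      rw [pow_zero] at hz
      obtain ⟨a, rfl⟩ := Submodule.mem_one.1 hz
      rw [Algebra.algebraMap_eq_smul_one, map_smul, map_smul, map_one, hψ1]
    | succ e ih =>
      intro he z hz
      rw [pow_succ'] at hz
      refine Submodule.mul_induction_on hz (fun a ha b hb => ?_) fun a b ha hb => ?_
      · rw [map_mul, hxC a ha, ih (by omega) b hb,
          hψ a (hle1 ha) b (hle (by omega) hb)]
      · rw [map_add, map_add, ha, hb]
  exact ⟨x, fun z hz => hxpow d le_rfl z hz⟩

end Extension

/-! ### Normalized operator algebras from prescribed data -/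

namespace OperatorAlgebra
variable {r : ℕ} {ι k F : Type*} [Fintype ι] [DecidableEq ι] [Field k] [Field F] [Algebra k F]

/-- The normalized operator algebra with prescribed multiplication and operators. -/
def ofOps (ops : Fin r → Matrix ι ι k) (m : ι → ι → ι → k) : OperatorAlgebra r ι k where
  mulCoeff := m
  -- Indices 0 to 3 and `r + 4` are reserved for the normalization, so the given operators occupy 4
  -- to `r + 3`.
  op i := if h : 4 ≤ i ∧ i < r + 4 then ops ⟨i - 4, by omega⟩ else if i = 1 ∨ i = 2 then 0 else 1

omit [Fintype ι] in
lemma ofOps_isNormalized (ops : Fin r → Matrix ι ι k) (m : ι → ι → ι → k) :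
    (ofOps ops m).IsNormalized where
  op_zero := by simp [ofOps]
  op_one := by simp [ofOps]
  op_two := by simp [ofOps]
  op_three := by simp [ofOps]
  op_last := by
    simp only [ofOps]
    rw [dif_neg (by omega), if_neg (by omega)]

lemma mem_stab_ofOps {ops : Fin r → Matrix ι ι k} {m : ι → ι → ι → k} {G : (Matrix ι ι F)ˣ} :
    G ∈ ((ofOps ops m).map (algebraMap k F)).stab ↔
      (∀ i, (ops i).map (algebraMap k F) * G.val = G.val * (ops i).map (algebraMap k F)) ∧
      ∀ i j l, ∑ a, ∑ b, algebraMap k F (m a b l) * (G.val a i * G.val b j) =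
        ∑ c, G.val l c * algebraMap k F (m i j c) := by
  constructor
  · rintro ⟨h1, h2⟩
    refine ⟨fun i => ?_, fun i j l => ?_⟩
    · have h := h1 (i + 4) (by omega)
      simpa [OperatorAlgebra.map, ofOps] using h
    · have h := congrFun (h2 (Pi.single i 1) (Pi.single j 1)) l
      rw [mulVec_single, Matrix.mulVec_single_one, Matrix.mulVec_single_one] at h
      exact h
  · rintro ⟨h1, h2⟩
    refine ⟨fun i _ => ?_, mulVec_mulVec_of_single h2⟩
    simp only [OperatorAlgebra.map, ofOps]
    split_ifs
    · exact h1 _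
    · simp
    · simp

end OperatorAlgebra

lemma sum_smul_sum_smul_comm {k W σ τ : Type*} [Field k] [AddCommGroup W] [Module k W] [Fintype σ]
    [Fintype τ] (f : σ → k) (g : τ → k) (w : τ → σ → W) :
    ∑ c, f c • ∑ l, g l • w l c = ∑ l, g l • ∑ c, f c • w l c := by
  simp only [Finset.smul_sum]
  rw [Finset.sum_comm]
  exact Finset.sum_congr rfl fun _ _ => Finset.sum_congr rfl fun _ _ => smul_comm _ _ _

/-- The group of points of a commutative Hopf algebra with values in a commutative algebra, with the
monoid structure given by convolution. -/
abbrev pointGroup (k H F : Type*) [Field k] [CommRing H] [HopfAlgebra k H] [CommRing F]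
    [Algebra k F] : Group (WithConv (H →ₐ[k] F)) where
  inv x := .toConv (x.ofConv.comp (HopfAlgebra.antipodeAlgHom k H))
  inv_mul_cancel x := by
    have h := AlgHom.comp_convMul_distrib x.ofConv
      (WithConv.toConv (HopfAlgebra.antipodeAlgHom k H)) (WithConv.toConv (AlgHom.id k H))
    rw [AlgHom.antipode_id_cancel] at h
    apply WithConv.ofConv_injective
    refine h.symm.trans ?_
    ext z
    exact (x.ofConv.commutes _)

/-! ### Rational points as equivariant pairs of matrices -/

section Equivariant
variable {k H : Type*} [Field k] [CommRing H] [HopfAlgebra k H]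
variable {U V : Submodule k H} {p q : ℕ} (B : Frame U p) (E : Frame V q)

namespace Frame

/-- The pairs of matrices which commute with left translations, with the inclusion of `U` in `V`,
and with the multiplication `U × U → V`. -/
structure IsEquivariant {R : Type*} [CommRing R] [Algebra k R] (M : Matrix (Fin p) (Fin p) R)
    (N : Matrix (Fin q) (Fin q) R) : Prop where
  translation : ∀ a c j, ∑ b, B.form c (B.coeff a b) • M b j = ∑ b, B.form b (B.coeff a j) • M c b
  inclusion : ∀ l i, ∑ a, E.form l (B.vec a) • M a i = ∑ c, E.form c (B.vec i) • N l c
  multiplication : ∀ i j l, ∑ a, ∑ b, E.form l (B.vec a * B.vec b) • (M a i * M b j) =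
    ∑ c, E.form c (B.vec i * B.vec j) • N l c

lemma IsEquivariant.map {R S : Type*} [CommRing R] [Algebra k R] [CommRing S] [Algebra k S]
    {M : Matrix (Fin p) (Fin p) R} {N : Matrix (Fin q) (Fin q) R} (h : B.IsEquivariant E M N)
    (x : R →ₐ[k] S) : B.IsEquivariant E (M.map x) (N.map x) where
  translation a c j := by
    simpa only [map_sum, map_smul, Matrix.map_apply] using congrArg x (h.translation a c j)
  inclusion l i := by
    simpa only [map_sum, map_smul, Matrix.map_apply] using congrArg x (h.inclusion l i)
  multiplication i j l := by
    simpa only [map_sum, map_smul, map_mul, Matrix.map_apply] using congrArg x (h.multiplication i j l)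

/-- This is the case of the universal point: commutation with translations is coassociativity, and
compatibility with products is multiplicativity of `Δ`. Every rational point is a specialisation of
it. -/
lemma isEquivariant_coeff (hU : IsSubcoalgebra U) (hUV : U ≤ V)
    (hmul : U * U ≤ V) :
    B.IsEquivariant E (Matrix.of B.coeff) (Matrix.of E.coeff) where
  translation a c j := by
    have h1 := B.contractFst_form_comul (B.coeff_mem hU a j) c
    rw [B.comul_coeff hU.isRightSubcomodule] at h1
    simpa using h1
  inclusion l i := by
    have h1 := E.contractFst_form_comul (hUV (B.vec_mem i)) l
    rw [B.comul_vec hU.isRightSubcomodule] at h1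
    simpa using h1
  multiplication i j l := by
    have h1 := E.contractFst_form_comul (hmul (Submodule.mul_mem_mul (B.vec_mem i) (B.vec_mem j))) l
    rw [Bialgebra.comul_mul, B.comul_vec hU.isRightSubcomodule,
      B.comul_vec hU.isRightSubcomodule, Finset.sum_mul_sum] at h1
    simpa using h1

lemma span_vec : Submodule.span k (Set.range B.vec) = U := by
  apply le_antisymm
  · rw [Submodule.span_le]
    rintro _ ⟨i, rfl⟩
    exact B.vec_mem i
  · intro z hz
    rw [← B.sum_form_smul_vec z hz]
    exact Submodule.sum_mem _ fun i _ =>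
      Submodule.smul_mem _ _ (Submodule.subset_span ⟨i, rfl⟩)

/-- Linear maps which agree on the products of basis vectors agree on the products. -/
lemma eqOn_mul {W : Type*} [AddCommGroup W] [Module k W] {f g : H →ₗ[k] W}
    (h : ∀ i j, f (B.vec i * B.vec j) = g (B.vec i * B.vec j)) : ∀ z ∈ U * U, f z = g z := by
  have hle : U * U ≤ LinearMap.eqLocus f g := by
    conv_lhs => rw [← B.span_vec]
    rw [Submodule.span_mul_span, Submodule.span_le]
    rintro _ ⟨_, ⟨i, rfl⟩, _, ⟨j, rfl⟩, rfl⟩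
    exact h i j
  exact fun z hz => hle hz

section Field
variable {F : Type*} [Field F] [Algebra k F]

/-- The linear form on `V` obtained from the counit by a matrix. -/
def formOfMatrix (N : Matrix (Fin q) (Fin q) F) : H →ₗ[k] F :=
  ∑ c, LinearMap.toSpanSingleton k F (∑ l, counit (R := k) (E.vec l) • N l c) ∘ₗ E.form c

lemma formOfMatrix_apply (N : Matrix (Fin q) (Fin q) F) (z : H) :
    E.formOfMatrix N z = ∑ c, E.form c z • ∑ l, counit (R := k) (E.vec l) • N l c := by
  simp [formOfMatrix, LinearMap.sum_apply]

lemma sum_form_smul_counit {z : H} (hz : z ∈ V) :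
    ∑ l, E.form l z * counit (R := k) (E.vec l) = counit (R := k) z := by
  conv_rhs => rw [← E.sum_form_smul_vec z hz]
  simp

/-- The hypothesis is the identity `N z = ∑ y s • m s` in coordinates, and the counit is applied to
it. For a translation by `x` the resulting form is `x` itself, since `(ε ⊗ x) Δ = x`. -/
lemma formOfMatrix_eq {N : Matrix (Fin q) (Fin q) F} {z : H} {σ : Type*} [Fintype σ] {y : σ → H}
    (hy : ∀ s, y s ∈ V) {m : σ → F}
    (h : ∀ l, ∑ s, E.form l (y s) • m s = ∑ c, E.form c z • N l c) :
    E.formOfMatrix N z = ∑ s, counit (R := k) (y s) • m s := by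
  calc E.formOfMatrix N z
      = ∑ l, counit (R := k) (E.vec l) • ∑ c, E.form c z • N l c := by
        rw [formOfMatrix_apply]
        exact sum_smul_sum_smul_comm (fun c => E.form c z) (fun l => counit (R := k) (E.vec l))
          fun l c => N l c
    _ = ∑ s, (∑ l, E.form l (y s) * counit (R := k) (E.vec l)) • m s := by
        simp only [← h]
        simp only [Finset.smul_sum, Finset.sum_smul]
        rw [Finset.sum_comm]
        exact Finset.sum_congr rfl fun _ _ => Finset.sum_congr rfl fun _ _ => by
          rw [← mul_smul, mul_comm]
    _ = _ := by simp only [E.sum_form_smul_counit (hy _)]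

variable {B E} {M : Matrix (Fin p) (Fin p) F} {N : Matrix (Fin q) (Fin q) F}

lemma IsEquivariant.formOfMatrix_vec (h : B.IsEquivariant E M N) (hUV : U ≤ V) (i : Fin p) :
    E.formOfMatrix N (B.vec i) = ∑ a, counit (R := k) (B.vec a) • M a i :=
  E.formOfMatrix_eq (fun a => hUV (B.vec_mem a)) fun l => h.inclusion l i

/-- Equivariance turns `N` of a product into the product of the images under `M`, and the counit is
multiplicative. -/
lemma IsEquivariant.formOfMatrix_vec_mul_vec (h : B.IsEquivariant E M N) (hUV : U ≤ V)
    (hmul : U * U ≤ V) (i j : Fin p) :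
    E.formOfMatrix N (B.vec i * B.vec j) =
      E.formOfMatrix N (B.vec i) * E.formOfMatrix N (B.vec j) := by
  rw [E.formOfMatrix_eq (σ := Fin p × Fin p) (y := fun s => B.vec s.1 * B.vec s.2)
    (m := fun s => M s.1 i * M s.2 j)
    (fun s => hmul (Submodule.mul_mem_mul (B.vec_mem s.1) (B.vec_mem s.2)))
    (fun l => by rw [Fintype.sum_prod_type]; exact h.multiplication i j l),
    h.formOfMatrix_vec hUV, h.formOfMatrix_vec hUV, Finset.sum_mul_sum, Fintype.sum_prod_type]
  simp only [Bialgebra.counit_mul, smul_mul_smul_comm]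

lemma IsEquivariant.formOfMatrix_mul (h : B.IsEquivariant E M N) (hUV : U ≤ V)
    (hmul : U * U ≤ V) {a b : H} (ha : a ∈ U) (hb : b ∈ U) :
    E.formOfMatrix N (a * b) = E.formOfMatrix N a * E.formOfMatrix N b := by
  rw [← B.sum_form_smul_vec a ha, ← B.sum_form_smul_vec b hb, Finset.sum_mul_sum]
  simp only [map_sum, map_smul, smul_mul_smul_comm, h.formOfMatrix_vec_mul_vec hUV hmul,
    Finset.sum_mul_sum]

/-- Let `T_c = (B.form c ⊗ id) Δ`. Then `ε ∘ T_c = B.form c` on `U` and `T_c` sends `B.vec j` to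
`B.coeff c j`, so commuting `M` past `T_c` turns the entry of `M` into a value of `ε ∘ M`. -/
lemma IsEquivariant.formOfMatrix_coeff (h : B.IsEquivariant E M N) (hU : IsSubcoalgebra U)
    (hUV : U ≤ V) (c j : Fin p) : E.formOfMatrix N (B.coeff c j) = M c j := by
  calc E.formOfMatrix N (B.coeff c j)
      = ∑ b, B.form b (B.coeff c j) • ∑ i, counit (R := k) (B.vec i) • M i b := by
        conv_lhs => rw [← B.sum_form_smul_vec _ (B.coeff_mem hU c j)]
        simp only [map_sum, map_smul, h.formOfMatrix_vec hUV]
    _ = ∑ i, counit (R := k) (B.vec i) • ∑ b, B.form b (B.coeff c j) • M i b := by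
        exact sum_smul_sum_smul_comm (fun b => B.form b (B.coeff c j))
          (fun i => counit (R := k) (B.vec i)) fun i b => M i b
    _ = ∑ b, (∑ i, B.form i (B.coeff c b) * counit (R := k) (B.vec i)) • M b j := by
        simp only [← h.translation]
        simp only [Finset.smul_sum, Finset.sum_smul]
        rw [Finset.sum_comm]
        exact Finset.sum_congr rfl fun _ _ => Finset.sum_congr rfl fun _ _ => by
          rw [← mul_smul, mul_comm]
    _ = M c j := by
        simp [B.sum_form_smul_counit (B.coeff_mem hU _ _), B.counit_coeff]

/-- Over a field, an equivariant pair of matrices comes from a rational point. -/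
theorem IsEquivariant.exists_algHom (h : B.IsEquivariant E M N) (hU : IsSubcoalgebra U)
    (hone : 1 ∈ U) (hUV : U ≤ V) (hmul : U * U = V) (hM : M ≠ 0)
    (hext : ∀ ψ : H →ₗ[k] F, ψ 1 = 1 → (∀ a ∈ U, ∀ b ∈ U, ψ (a * b) = ψ a * ψ b) →
      ∃ x : H →ₐ[k] F, ∀ z ∈ U, x z = ψ z) :
    ∃ x : H →ₐ[k] F, M = (Matrix.of B.coeff).map x ∧ N = (Matrix.of E.coeff).map x := by
  have hψmul : ∀ a ∈ U, ∀ b ∈ U, E.formOfMatrix N (a * b) =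
      E.formOfMatrix N a * E.formOfMatrix N b :=
    fun a ha b hb => h.formOfMatrix_mul hUV hmul.le ha hb
  have hψone : E.formOfMatrix N 1 = 1 := by
    -- A nonzero entry of `M` is a nonzero value of the form on `U`; multiplicativity on `1` times
    -- this element then allows cancellation.
    obtain ⟨c, j, hcj⟩ : ∃ c j, M c j ≠ 0 := by
      by_contra! hc
      exact hM (Matrix.ext hc)
    rw [← h.formOfMatrix_coeff hU hUV] at hcj
    have h1 := hψmul 1 hone _ (B.coeff_mem hU c j)
    rw [one_mul] at h1
    exact mul_right_cancel₀ hcj (by rw [← h1, one_mul])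
  obtain ⟨x, hx⟩ := hext _ hψone hψmul
  have hMx : M = (Matrix.of B.coeff).map x := by
    ext c j
    rw [Matrix.map_apply, Matrix.of_apply, hx _ (B.coeff_mem hU c j),
      h.formOfMatrix_coeff hU hUV]
  refine ⟨x, hMx, ?_⟩
  have hx' := (B.isEquivariant_coeff E hU hUV hmul.le).map B E x
  ext l c
  -- Row `l` of `N` is read as a linear form on `V = U * U`. It is determined on products of basis
  -- vectors, where equivariance expresses it through `M`.
  let f (N : Matrix (Fin q) (Fin q) F) : H →ₗ[k] F :=
    ∑ c, LinearMap.toSpanSingleton k F (N l c) ∘ₗ E.form c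
  have hf : ∀ N z, f N z = ∑ c, E.form c z • N l c := by
    intro N z
    simp [f, LinearMap.sum_apply]
  have hfc : ∀ N, f N (E.vec c) = N l c := by
    intro N
    simp [hf, E.form_vec]
  rw [← hfc N, ← hfc (Matrix.map _ _)]
  refine B.eqOn_mul (fun i j => ?_) _ (hmul ▸ E.vec_mem c)
  rw [hf, hf, ← h.multiplication, ← hx'.multiplication, hMx]

end Field

/-- The operators on the sum of `U` and `V`: the projection to `U`, the inclusion of `U` in `V`, and
left translations on `U`. -/
def ops : Fin (p + 2) → Matrix (Fin p ⊕ Fin q) (Fin p ⊕ Fin q) k :=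
  Fin.cons (Matrix.fromBlocks 1 0 0 0)
    (Fin.cons (Matrix.fromBlocks 0 0 (Matrix.of fun l i => E.form l (B.vec i)) 0)
      fun a => Matrix.fromBlocks (Matrix.of fun b j => B.form b (B.coeff a j)) 0 0 0)

/-- The multiplication on the sum of `U` and `V` which is given by `U × U → V`. -/
def mulCoeff : Fin p ⊕ Fin q → Fin p ⊕ Fin q → Fin p ⊕ Fin q → k
  | .inl i, .inl j, .inr l => E.form l (B.vec i * B.vec j)
  | _, _, _ => 0

/-- The operator algebra on the sum of `U` and `V`. -/
def operatorAlgebra : OperatorAlgebra (p + 2) (Fin p ⊕ Fin q) k :=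
  .ofOps (B.ops E) (B.mulCoeff E)

/-- Commutation with the projection to `U` kills the off-diagonal blocks; the remaining conditions
are then the equivariance identities entry by entry. -/
lemma mem_stab_operatorAlgebra {F : Type*} [Field F] [Algebra k F]
    {G : (Matrix (Fin p ⊕ Fin q) (Fin p ⊕ Fin q) F)ˣ} :
    G ∈ ((B.operatorAlgebra E).map (algebraMap k F)).stab ↔
      ∃ M N, G.val = Matrix.fromBlocks M 0 0 N ∧ B.IsEquivariant E M N := by
  rw [operatorAlgebra, OperatorAlgebra.mem_stab_ofOps]
  simp only [Fin.forall_fin_succ (n := p + 1), Fin.forall_fin_succ (n := p), ops, Fin.cons_zero,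
    Fin.cons_succ]
  constructor
  · rintro ⟨⟨h1, h2, h3⟩, h4⟩
    obtain ⟨M, X, Y, N, hG⟩ : ∃ M X Y N, G.val = Matrix.fromBlocks M X Y N :=
      ⟨_, _, _, _, (Matrix.fromBlocks_toBlocks G.val).symm⟩
    rw [hG] at h1 h2 h3 h4
    simp only [Matrix.fromBlocks_map, Matrix.fromBlocks_multiply] at h1 h2 h3
    simp only [Matrix.fromBlocks_inj] at h1 h2 h3
    obtain ⟨-, hX, hY, -⟩ := h1
    have hX : X = 0 := by simpa using hX
    have hY : Y = 0 := by simpa using hY.symm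
    subst hX hY
    refine ⟨M, N, hG, ⟨fun a c j => ?_, fun l i => ?_, fun i j l => ?_⟩⟩
    · have h := congrFun (congrFun (h3 a).1 c) j
      simpa [Matrix.mul_apply, Algebra.smul_def, mul_comm] using h
    · have h := congrFun (congrFun h2.2.2.1 l) i
      simpa [Matrix.mul_apply, Algebra.smul_def, mul_comm] using h
    · have h := h4 (.inl i) (.inl j) (.inr l)
      simpa [Fintype.sum_sum_type, mulCoeff, Algebra.smul_def, mul_comm] using h
  · rintro ⟨M, N, hG, h⟩
    rw [hG]
    simp only [Matrix.fromBlocks_map, Matrix.fromBlocks_multiply]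
    simp only [Matrix.fromBlocks_inj]
    refine ⟨⟨by simp, ?_, fun a => ?_⟩, ?_⟩
    · refine ⟨by simp, by simp, ?_, by simp⟩
      ext l i
      simpa [Matrix.mul_apply, Algebra.smul_def, mul_comm] using h.inclusion l i
    · refine ⟨?_, by simp, by simp, by simp⟩
      ext c j
      simpa [Matrix.mul_apply, Algebra.smul_def, mul_comm] using h.translation a c j
    · rintro (i | i) (j | j) (l | l)
      · simp [Fintype.sum_sum_type, mulCoeff]
      · simpa [Fintype.sum_sum_type, mulCoeff, Algebra.smul_def, mul_comm] using
          h.multiplication i j l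
      all_goals simp [Fintype.sum_sum_type, mulCoeff]

/-- The action of rational points on a subcomodule. -/
def pointMatrix (hU : IsRightSubcomodule U) (F : Type*) [Field F] [Algebra k F] :
    WithConv (H →ₐ[k] F) →* Matrix (Fin p) (Fin p) F where
  toFun x := (Matrix.of B.coeff).map x.ofConv
  map_one' := by
    ext i j
    rw [Matrix.map_apply, Matrix.of_apply]
    change algebraMap k F (counit (R := k) (B.coeff i j)) = _
    rw [B.counit_coeff, Matrix.one_apply]
    split_ifs <;> simp
  map_mul' x y := by
    ext i j
    rw [Matrix.map_apply, Matrix.of_apply, AlgHom.convMul_apply, B.comul_coeff hU]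
    simp [Matrix.mul_apply]

/-- The action of rational points on the sum of two subcomodules. -/
def blockMatrix (hU : IsRightSubcomodule U) (hV : IsRightSubcomodule V) (F : Type*) [Field F]
    [Algebra k F] : WithConv (H →ₐ[k] F) →* Matrix (Fin p ⊕ Fin q) (Fin p ⊕ Fin q) F where
  toFun x := Matrix.fromBlocks (B.pointMatrix hU F x) 0 0 (E.pointMatrix hV F x)
  map_one' := by simp
  map_mul' x y := by simp [Matrix.fromBlocks_multiply]

end Frame
end Equivariant
end

/-! ### The simple algebra attached to the group -/

theorem corollary1 (k : Type u) [Field k]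
    (H : Type v) [CommRing H] [HopfAlgebra k H] [Algebra.FiniteType k H]
    [Algebra.IsGeometricallyReduced k H]
    (hk : HasSufficientlyManyElements k H) :
    ∃ (A : Type u) (_ : NonUnitalNonAssocRing A) (_ : Module k A) (_ : IsScalarTower k A A)
      (_ : SMulCommClass k A A) (_ : FiniteDimensional k A),
      IsSimpleNonassocAlgebra k A ∧
      ∀ (F : Type w) [Field F] [Algebra k F],
        Nonempty (WithConv (H →ₐ[k] F) ≃* nonassocAut F (F ⊗[k] A)) := by
  obtain ⟨C, hCfg, hC, hC1, hCgen⟩ := exists_fg_isSubcoalgebra_adjoin_eq_top (k := k) (H := H)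
  -- The exponent does not depend on `F`, so a single algebra serves all extensions.
  obtain ⟨d, hd, hext⟩ := exists_algHom_eq_on_pow.{_, _, w} hCfg hC1 hCgen
  obtain ⟨p, ⟨B⟩⟩ := exists_frame (hCfg.pow d)
  obtain ⟨q, ⟨E⟩⟩ := exists_frame ((hCfg.pow d).mul (hCfg.pow d))
  have hU : IsSubcoalgebra (C ^ d) := hC.pow d
  have hV := hU.mul hU
  have hone : 1 ≤ C ^ d := one_le_pow₀ hC1
  have hone' : (1 : H) ∈ C ^ d := Submodule.one_le.1 hone
  have hUV : C ^ d ≤ C ^ d * C ^ d := le_mul_of_one_le_left' hone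
  have hCU : C ≤ C ^ d := le_self_pow₀ hC1 hd
  have : Nontrivial H :=
    (RingHom.domain_nontrivial (Bialgebra.counitAlgHom k H).toRingHom)
  -- Simplicity needs a nonzero space of vectors; here `U` contains `1 ≠ 0`.
  have hp : Nonempty (Fin p) := by
    by_contra hp
    rw [not_nonempty_iff] at hp
    have h := B.sum_form_smul_vec 1 hone'
    rw [Finset.univ_eq_empty, Finset.sum_empty] at h
    exact zero_ne_one h
  obtain ⟨i₀⟩ := hp
  have : Nonempty (Fin p ⊕ Fin q) := ⟨.inl i₀⟩
  have hD : (B.operatorAlgebra E).IsNormalized := OperatorAlgebra.ofOps_isNormalized _ _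
  refine ⟨OperatorAlgebra.Rigid (B.operatorAlgebra E), inferInstance, inferInstance, inferInstance,
    inferInstance, inferInstance, OperatorAlgebra.Rigid.isSimple hD, fun F _ _ => ?_⟩
  let φ : WithConv (H →ₐ[k] F) →* ((B.operatorAlgebra E).map (algebraMap k F)).stab :=
    -- Inverses of points, given by the antipode, make the matrices of the action invertible.
    letI := pointGroup k H F
    (MonoidHom.toHomUnits
      (B.blockMatrix E hU.isRightSubcomodule hV.isRightSubcomodule F)).codRestrict _
      fun x : WithConv (H →ₐ[k] F) => (B.mem_stab_operatorAlgebra E).2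
        ⟨_, _, rfl, (B.isEquivariant_coeff E hU hUV le_rfl).map B E x.ofConv⟩
  have hφ : ∀ x, (φ x).1.val = Matrix.fromBlocks ((Matrix.of B.coeff).map x.ofConv) 0 0
    ((Matrix.of E.coeff).map x.ofConv) := fun _ => rfl
  have hinj : Function.Injective φ := by
    intro x y hxy
    have h1 : (φ x).1.val = (φ y).1.val := by rw [hxy]
    rw [hφ, hφ, Matrix.fromBlocks_inj] at h1
    have h2 : ∀ i j, x.ofConv (B.coeff i j) = y.ofConv (B.coeff i j) :=
      fun i j => congrFun (congrFun h1.1 i) j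
    apply WithConv.ofConv_injective
    -- The coefficients recover the basis of `U` through the counit, and `U` contains the generating
    -- space `C`.
    refine AlgHom.ext_of_adjoin_eq_top hCgen fun z hz => ?_
    have h3 := B.sum_form_smul_vec z (hCU hz)
    have h4 : ∀ j, x.ofConv (B.vec j) = y.ofConv (B.vec j) := fun j => by
      rw [← B.sum_counit_smul_coeff hU.isRightSubcomodule j]
      simp only [map_sum, map_smul, h2]
    rw [← h3]
    simp only [map_sum, map_smul, h4]
  have hsurj : Function.Surjective φ := by
    rintro ⟨G, hG⟩
    obtain ⟨M, N, hMN, h⟩ := (B.mem_stab_operatorAlgebra E).1 hG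
    -- The block matrix is invertible and its first block is nonempty.
    have hM : M ≠ 0 := by
      rintro rfl
      have h1 := congrFun (congrFun G.inv_mul (.inl i₀)) (.inl i₀)
      rw [hMN] at h1
      simp [Matrix.mul_apply] at h1
    obtain ⟨x, hx, hx'⟩ := h.exists_algHom hU hone' hUV rfl hM (hext F)
    refine ⟨WithConv.toConv x, Subtype.ext (Units.ext ?_)⟩
    rw [hφ, hMN, hx, hx']
  exact ⟨((MulEquiv.ofBijective φ ⟨hinj, hsurj⟩).trans
    (OperatorAlgebra.Rigid.stabEquiv hD.map)).trans
    (nonassocAut.congr (OperatorAlgebra.Rigid.baseChangeEquiv F (B.operatorAlgebra E))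
      (OperatorAlgebra.Rigid.baseChangeEquiv_mul F _)).symm⟩
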